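/- Let $k$ be a commutative ring, let $A$ be a ($\mathbb Z$-graded, unital, associative) dg algebra over $k$, let $n\ge 1$ and $R_n=k[t]/(t^{n+1})$. Let $A_n$ be a cdg deformation of $A$ of order $n$: a structure of curved dg $R_n$-algebra on the graded $R_n$-module $R_n\otimes_k A\cong A[t]/(t^{n+1})$ which reduces modulo $t$ to the dg algebra structure of $A$ (so its curvature $c\in A_n^2$ lies in $tA_n$). For $0\le m\le n$ put $A_m=A_n/t^{m+1}A_n$. A (left) cdg $A_m$-module is a graded module $M$ with a derivation $d_M$ of degree $1$ such that $d_M^2$ is the action of the curvature. Let $\operatorname{Hot}(A_m)$ be the category of cdg $A_m$-modules and homotopy classes of closed morphisms of degree $0$. A cdg $A_m$-module $M$ is called $m$-acyclic if the complexes $t^iM/t^{i+1}M$ are acyclic for $0\le i\le m$. The $m$-derived category $D^m(A_m)$ is the (Verdier) quotient of $\operatorname{Hot}(A_m)$ by the $m$-acyclic modules, i.e. the localization of $\operatorname{Hot}(A_m)$ at the morphisms whose cone is $m$-acyclic; $D(A)$ is the quotient of $\operatorname{Hot}(A)$ by the acyclic modules. For $1\le m\le n$ restriction of scalars along $A_m\to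 A_{m-1}$ carries $(m-1)$-acyclic modules to $m$-acyclic modules, and so induces a (forgetful) functor $\iota_m\colon D^{m-1}(A_{m-1})\to D^m(A_m)$. Then: 1. The functor $\iota_n\colon D^{n-1}(A_{n-1})\to D^n(A_n)$ is fully faithful, and its essential image consists of the cdg $A_n$-modules $M$ for which $t^nM$ is acyclic. 2. Restriction of scalars along the isomorphism $A_0\cong A$ induces an equivalence $D(A)\simeq D^0(A_0)$, and for every $1\le m\le n$ the functor $\iota_m$ is fully faithful, with essential image the cdg $A_m$-modules $M$ for which $t^mM$ is acyclic. In particular there is a chain of embeddings (fully faithful functors) $$D(A)\simeq D^0(A_0)\overset{\iota_1}{\hookrightarrow}D^1(A_1)\hookrightarrow\cdots\hookrightarrow D^{n-1}(A_{n-1})\overset{\iota_n}{\hookrightarrow}D^n(A_n).$$ -/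

import Mathlib

open CategoryTheory
open scoped TensorProduct Polynomial

universe u u' v v' w

noncomputable section

/-! ### Curved dg algebras

Graded objects are families indexed by `ℤ`.  Products are written `mul (h : i + j = l)`, so that the
target degree `l` may be any expression equal to `i + j`. -/

/-- A structure of cdg algebra over `R` on the graded `R`-module `A`: a unital associative graded
`R`-algebra with an `R`-linear derivation `d` of degree `1` and a curvature `curv ∈ A²` such that
`d curv = 0` and `d² = [curv, -]`. -/
structure CDGAlgebra (R : Type u) [CommRing R] (A : ℤ → Type v)
    [∀ i, AddCommGroup (A i)] [∀ i, Module R (A i)] where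
  mul {i j l : ℤ} (h : i + j = l) : A i →ₗ[R] A j →ₗ[R] A l
  one : A 0
  one_mul {i : ℤ} (h : 0 + i = i) (a : A i) : mul h one a = a
  mul_one {i : ℤ} (h : i + 0 = i) (a : A i) : mul h a one = a
  mul_assoc {i j l ij jl ijl : ℤ} (hij : i + j = ij) (hjl : j + l = jl)
    (h₁ : ij + l = ijl) (h₂ : i + jl = ijl) (a : A i) (b : A j) (c : A l) :
    mul h₁ (mul hij a b) c = mul h₂ a (mul hjl b c)
  d (i : ℤ) : A i →ₗ[R] A (i + 1)
  leibniz {i j l : ℤ} (h : i + j = l) (h₁ : (i + 1) + j = l + 1) (h₂ : i + (j + 1) = l + 1)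
    (a : A i) (b : A j) :
    d l (mul h a b) = mul h₁ (d i a) b + i.negOnePow • mul h₂ a (d j b)
  curv : A 2
  d_curv : d 2 curv = 0
  d_d {i : ℤ} (h₁ : 2 + i = i + 1 + 1) (h₂ : i + 2 = i + 1 + 1) (a : A i) :
    d (i + 1) (d i a) = mul h₁ curv a - mul h₂ a curv

/-- A dg algebra over `k`: a cdg algebra with zero curvature. -/
structure DGAlgebra (k : Type u) [CommRing k] (A : ℤ → Type v)
    [∀ i, AddCommGroup (A i)] [∀ i, Module k (A i)] extends CDGAlgebra k A where
  curv_eq_zero : curv = 0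

section Basic

variable {R : Type u} [CommRing R] {A : ℤ → Type v}
  [∀ i, AddCommGroup (A i)] [∀ i, Module R (A i)]

/-- A (strict) morphism of cdg algebras, linear over a ring homomorphism `σ` of the base rings. -/
structure CDGAlgebraHom {S : Type u'} [CommRing S] {B : ℤ → Type v'}
    [∀ i, AddCommGroup (B i)] [∀ i, Module S (B i)] (σ : R →+* S)
    (E : CDGAlgebra R A) (F : CDGAlgebra S B) where
  toFun (i : ℤ) : A i →ₛₗ[σ] B i
  map_mul {i j l : ℤ} (h : i + j = l) (a : A i) (b : A j) :
    toFun l (E.mul h a b) = F.mul h (toFun i a) (toFun j b)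
  map_one : toFun 0 E.one = F.one
  map_d {i : ℤ} (a : A i) : toFun (i + 1) (E.d i a) = F.d i (toFun i a)
  map_curv : toFun 2 E.curv = F.curv

theorem CDGAlgebra.d_one (E : CDGAlgebra R A) : E.d 0 E.one = 0 := by
  have h := E.leibniz (add_zero 0) (by norm_num) (by norm_num) E.one E.one
  rw [E.one_mul (add_zero 0)] at h
  have e1 : E.mul (show (0 + 1 : ℤ) + 0 = 0 + 1 by norm_num) (E.d 0 E.one) E.one = E.d 0 E.one :=
    E.mul_one _ _
  have e2 : E.mul (show (0 : ℤ) + (0 + 1) = 0 + 1 by norm_num) E.one (E.d 0 E.one) = E.d 0 E.one :=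
    E.one_mul _ _
  rw [e1, e2, Int.negOnePow_zero, one_smul] at h
  exact (left_eq_add.mp h)

/-! ### The quotient `E / rE` of a cdg algebra -/

/-- The submodule `r A i` of `A i`. -/
abbrev scalarSubmodule (A : ℤ → Type v) [∀ i, AddCommGroup (A i)] [∀ i, Module R (A i)]
    (r : R) (i : ℤ) : Submodule R (A i) :=
  LinearMap.range (LinearMap.lsmul R (A i) r)

theorem map_mem_scalarSubmodule (r : R) {i j : ℤ} (f : A i →ₗ[R] A j) {a : A i}
    (ha : a ∈ scalarSubmodule A r i) : f a ∈ scalarSubmodule A r j := by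
  obtain ⟨b, rfl⟩ := ha
  exact ⟨f b, by simp⟩

namespace CDGAlgebra

variable (E : CDGAlgebra R A)

/-- The product of `E / rE`. -/
def quotMul (r : R) {i j l : ℤ} (h : i + j = l) :
    (A i ⧸ scalarSubmodule A r i) →ₗ[R] (A j ⧸ scalarSubmodule A r j) →ₗ[R]
      (A l ⧸ scalarSubmodule A r l) :=
  Submodule.liftQ _
    { toFun := fun a => Submodule.mapQ _ _ (E.mul h a)
        (fun _ hb => map_mem_scalarSubmodule r (E.mul h a) hb)
      map_add' := fun a b => by
        ext x
        simp
      map_smul' := fun s a => by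
        ext x
        simp }
    (by
      intro a ha
      rw [LinearMap.mem_ker]
      ext x
      have hx := map_mem_scalarSubmodule r ((E.mul h).flip x) ha
      simpa [Submodule.Quotient.mk_eq_zero] using hx)

theorem quotMul_mk (r : R) {i j l : ℤ} (h : i + j = l) (a : A i) (b : A j) :
    E.quotMul r h (Submodule.Quotient.mk a) (Submodule.Quotient.mk b) =
      Submodule.Quotient.mk (E.mul h a b) := rfl

/-- The cdg algebra `E / rE`, for an element `r` of the base ring. -/
def quot (r : R) : CDGAlgebra R (fun i => A i ⧸ scalarSubmodule A r i) where
  mul h := E.quotMul r h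
  one := Submodule.Quotient.mk E.one
  one_mul h a := by
    obtain ⟨a, rfl⟩ := Submodule.Quotient.mk_surjective _ a
    rw [quotMul_mk, E.one_mul]
  mul_one h a := by
    obtain ⟨a, rfl⟩ := Submodule.Quotient.mk_surjective _ a
    rw [quotMul_mk, E.mul_one]
  mul_assoc hij hjl h₁ h₂ a b c := by
    obtain ⟨a, rfl⟩ := Submodule.Quotient.mk_surjective _ a
    obtain ⟨b, rfl⟩ := Submodule.Quotient.mk_surjective _ b
    obtain ⟨c, rfl⟩ := Submodule.Quotient.mk_surjective _ c
    simp only [quotMul_mk]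
    rw [E.mul_assoc hij hjl h₁ h₂]
  d i := Submodule.mapQ _ _ (E.d i) (fun _ ha => map_mem_scalarSubmodule r (E.d i) ha)
  leibniz {i j l} h h₁ h₂ a b := by
    obtain ⟨a, rfl⟩ := Submodule.Quotient.mk_surjective _ a
    obtain ⟨b, rfl⟩ := Submodule.Quotient.mk_surjective _ b
    simp only [quotMul_mk, Submodule.mapQ_apply]
    rw [E.leibniz h h₁ h₂]
    rfl
  curv := Submodule.Quotient.mk E.curv
  d_curv := by
    simp only [Submodule.mapQ_apply]
    rw [E.d_curv]
    rfl
  d_d h₁ h₂ a := by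
    obtain ⟨a, rfl⟩ := Submodule.Quotient.mk_surjective _ a
    simp only [quotMul_mk, Submodule.mapQ_apply]
    rw [E.d_d h₁ h₂]
    rfl

/-- The projection `E → E / rE`. -/
def quotProj (r : R) : CDGAlgebraHom (RingHom.id R) E (E.quot r) where
  toFun _ := Submodule.mkQ _
  map_mul _ _ _ := rfl
  map_one := rfl
  map_d _ := rfl
  map_curv := rfl

theorem scalarSubmodule_le_of_dvd {r s : R} (h : s ∣ r) (i : ℤ) :
    scalarSubmodule A r i ≤ scalarSubmodule A s i := by
  rintro _ ⟨a, rfl⟩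
  obtain ⟨c, rfl⟩ := h
  exact ⟨c • a, by simp [mul_smul, smul_comm c s a]⟩

/-- The projection `E / rE → E / sE`, for `s ∣ r`. -/
def quotFactor {r s : R} (h : s ∣ r) : CDGAlgebraHom (RingHom.id R) (E.quot r) (E.quot s) where
  toFun i := Submodule.factor (scalarSubmodule_le_of_dvd h i)
  map_mul _ a b := by
    obtain ⟨a, rfl⟩ := Submodule.Quotient.mk_surjective _ a
    obtain ⟨b, rfl⟩ := Submodule.Quotient.mk_surjective _ b
    rfl
  map_one := rfl
  map_d a := by
    obtain ⟨a, rfl⟩ := Submodule.Quotient.mk_surjective _ a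
    rfl
  map_curv := rfl

theorem quot_smul_one (r : R) : r • (E.quot r).one = 0 := by
  change Submodule.Quotient.mk (r • E.one) = 0
  rw [Submodule.Quotient.mk_eq_zero]
  exact ⟨E.one, rfl⟩

end CDGAlgebra

/-! ### cdg modules -/

/-- A left cdg module over `E`: a graded left module `X` with a derivation `d` of degree `1` such that
`d² = curv`.  The `R`-module structure of `X i` is the one given by `R → A 0`, see
`CDGModule.scal`; the derivation is then automatically `R`-linear, see `CDGModule.d_scal`. -/
structure CDGModule (E : CDGAlgebra R A) where
  X : ℤ → Type w
  [grp : ∀ i, AddCommGroup (X i)]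
  act {i j l : ℤ} (h : i + j = l) : A i →+ X j →+ X l
  one_act {i : ℤ} (h : 0 + i = i) (m : X i) : act h E.one m = m
  mul_act {i j l ij jl ijl : ℤ} (hij : i + j = ij) (hjl : j + l = jl)
    (h₁ : ij + l = ijl) (h₂ : i + jl = ijl) (a : A i) (b : A j) (m : X l) :
    act h₁ (E.mul hij a b) m = act h₂ a (act hjl b m)
  d (i : ℤ) : X i →+ X (i + 1)
  leibniz {i j l : ℤ} (h : i + j = l) (h₁ : (i + 1) + j = l + 1) (h₂ : i + (j + 1) = l + 1)
    (a : A i) (m : X j) :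
    d l (act h a m) = act h₁ (E.d i a) m + i.negOnePow • act h₂ a (d j m)
  d_d {i : ℤ} (h : 2 + i = i + 1 + 1) (m : X i) : d (i + 1) (d i m) = act h E.curv m

namespace CDGModule

attribute [instance] CDGModule.grp

variable {E : CDGAlgebra R A}

/-- The action of `r ∈ R` on the component `X i`. -/
def scal (M : CDGModule.{u, v, w} E) (r : R) (i : ℤ) : M.X i →+ M.X i :=
  M.act (zero_add i) (r • E.one)

theorem act_scal (M : CDGModule.{u, v, w} E) (r : R) {i j l : ℤ} (h : i + j = l)
    (a : A i) (m : M.X j) : M.act h a (M.scal r j m) = M.scal r l (M.act h a m) := by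
  unfold scal
  rw [← M.mul_act (add_zero i) (zero_add j) h h, ← M.mul_act (zero_add i) h h (zero_add l)]
  congr 2
  rw [map_smul, map_smul, LinearMap.smul_apply, E.mul_one, E.one_mul]

theorem d_scal (M : CDGModule.{u, v, w} E) (r : R) (i : ℤ) (m : M.X i) :
    M.d i (M.scal r i m) = M.scal r (i + 1) (M.d i m) := by
  unfold scal
  rw [M.leibniz (zero_add i) (by omega) (zero_add (i + 1)), map_smul, E.d_one]
  simp

theorem scal_mul (M : CDGModule.{u, v, w} E) (r s : R) (i : ℤ) (m : M.X i) :
    M.scal (r * s) i m = M.scal r i (M.scal s i m) := by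
  unfold scal
  rw [← M.mul_act (add_zero 0) (zero_add i) (zero_add i) (zero_add i)]
  congr 2
  rw [map_smul, map_smul, LinearMap.smul_apply, E.mul_one, mul_smul, smul_comm]

theorem scal_one (M : CDGModule.{u, v, w} E) (i : ℤ) (m : M.X i) : M.scal 1 i m = m := by
  unfold scal
  rw [one_smul, M.one_act]

/-- Closed morphisms of degree `0`. -/
@[ext]
structure Hom (M N : CDGModule.{u, v, w} E) where
  f (i : ℤ) : M.X i →+ N.X i
  map_act {i j l : ℤ} (h : i + j = l) (a : A i) (m : M.X j) :
    f l (M.act h a m) = N.act h a (f j m)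
  map_d {i : ℤ} (m : M.X i) : f (i + 1) (M.d i m) = N.d i (f i m)

/-- The underlying category `Z⁰` of the dg category of cdg modules over `E`: morphisms are the
closed morphisms of degree `0`. -/
instance : Category (CDGModule.{u, v, w} E) where
  Hom M N := Hom M N
  id M :=
    { f := fun _ => AddMonoidHom.id _
      map_act := fun _ _ _ => rfl
      map_d := fun _ => rfl }
  comp F G :=
    { f := fun i => (G.f i).comp (F.f i)
      map_act := fun h a m => by simp [F.map_act, G.map_act]
      map_d := fun m => by simp [F.map_d, G.map_d] }

/-- Two closed morphisms of degree `0` are homotopic if their difference is the differential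
`d ∘ s + s ∘ d` of a morphism `s` of degree `-1`, where `E`-linearity of `s` involves the usual
sign. -/
def Homotopic : HomRel (CDGModule.{u, v, w} E) := fun M N F G =>
  ∃ s : ∀ i : ℤ, M.X (i + 1) →+ N.X i,
    (∀ {i j l : ℤ} (h : i + j = l) (h' : i + (j + 1) = l + 1) (a : A i) (m : M.X (j + 1)),
      s l (M.act h' a m) = i.negOnePow • N.act h a (s j m)) ∧
    ∀ (i : ℤ) (m : M.X (i + 1)),
      F.f (i + 1) m - G.f (i + 1) m = N.d i (s i m) + s (i + 1) (M.d (i + 1) m)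

instance : Congruence (Homotopic (E := E)) where
  equivalence := by
    intro M N
    refine ⟨fun F => ⟨fun _ => 0, ?_, ?_⟩, ?_, ?_⟩
    · intros; simp
    · intros; simp
    · rintro F G ⟨s, hs, hs'⟩
      refine ⟨fun i => -s i, ?_, ?_⟩
      · intro i j l h h' a m
        simp [hs h h']
      · intro i m
        rw [← neg_sub, hs' i m]
        simp only [AddMonoidHom.neg_apply, map_neg]
        abel
    · rintro F G H ⟨s, hs, hs'⟩ ⟨r, hr, hr'⟩
      refine ⟨fun i => s i + r i, ?_, ?_⟩
      · intro i j l h h' a m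
        simp [hs h h', hr h h']
      · intro i m
        rw [← sub_add_sub_cancel _ (G.f (i + 1) m), hs' i m, hr' i m]
        simp only [AddMonoidHom.add_apply, map_add]
        abel
  comp_left := by
    rintro M N P F G G' ⟨s, hs, hs'⟩
    refine ⟨fun i => (s i).comp (F.f (i + 1)), ?_, ?_⟩
    · intro i j l h h' a m
      simp [F.map_act, hs h h']
    · intro i m
      have := hs' i (F.f (i + 1) m)
      rw [← F.map_d] at this
      exact this
  comp_right := by
    rintro M N P F F' G ⟨s, hs, hs'⟩
    refine ⟨fun i => (G.f i).comp (s i), ?_, ?_⟩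
    · intro i j l h h' a m
      have e : ∀ x : N.X l, G.f l (i.negOnePow • x) = i.negOnePow • G.f l x := fun x => by
        rw [Units.smul_def, Units.smul_def, map_zsmul]
      simp [hs h h', e, G.map_act]
    · intro i m
      have := congrArg (G.f (i + 1)) (hs' i m)
      rw [map_sub, map_add, G.map_d] at this
      exact this

/-! ### Submodules, quotients, the functors `rM` and `M / rM` -/

/-- The cdg submodule with components `N i`. -/
def ofSub (M : CDGModule.{u, v, w} E) (N : ∀ i, AddSubgroup (M.X i))
    (hact : ∀ {i j l : ℤ} (h : i + j = l) (a : A i) (m : M.X j), m ∈ N j → M.act h a m ∈ N l)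
    (hd : ∀ (i : ℤ) (m : M.X i), m ∈ N i → M.d i m ∈ N (i + 1)) : CDGModule.{u, v, w} E where
  X i := N i
  act {i j l} h := AddMonoidHom.mk'
    (fun a => ((M.act h a).comp (N j).subtype).codRestrict (N l) (fun m => hact h a m m.2))
    (fun a b => by
      ext m
      change M.act h (a + b) m.1 = M.act h a m.1 + M.act h b m.1
      simp)
  one_act h m := Subtype.ext (M.one_act h m.1)
  mul_act hij hjl h₁ h₂ a b m := Subtype.ext (M.mul_act hij hjl h₁ h₂ a b m.1)
  d i := ((M.d i).comp (N i).subtype).codRestrict (N (i + 1)) (fun m => hd i m m.2)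
  leibniz {i j l} h h₁ h₂ a m := Subtype.ext (by
    have := M.leibniz h h₁ h₂ a m.1
    rw [Units.smul_def] at this ⊢
    exact this)
  d_d h m := Subtype.ext (M.d_d h m.1)

/-- The quotient cdg module with components `X i / N i`. -/
def ofQuot (M : CDGModule.{u, v, w} E) (N : ∀ i, AddSubgroup (M.X i))
    (hact : ∀ {i j l : ℤ} (h : i + j = l) (a : A i) (m : M.X j), m ∈ N j → M.act h a m ∈ N l)
    (hd : ∀ (i : ℤ) (m : M.X i), m ∈ N i → M.d i m ∈ N (i + 1)) : CDGModule.{u, v, w} E where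
  X i := M.X i ⧸ N i
  act {i j l} h := AddMonoidHom.mk'
    (fun a => QuotientAddGroup.map (N j) (N l) (M.act h a) (fun m hm => hact h a m hm))
    (fun a b => by
      ext m
      change QuotientAddGroup.mk (s := N l) (M.act h (a + b) m) =
        QuotientAddGroup.mk (M.act h a m + M.act h b m)
      simp)
  one_act h m := by
    obtain ⟨m, rfl⟩ := QuotientAddGroup.mk_surjective m
    exact congrArg _ (M.one_act h m)
  mul_act hij hjl h₁ h₂ a b m := by
    obtain ⟨m, rfl⟩ := QuotientAddGroup.mk_surjective m
    exact congrArg _ (M.mul_act hij hjl h₁ h₂ a b m)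
  d i := QuotientAddGroup.map (N i) (N (i + 1)) (M.d i) (fun m hm => hd i m hm)
  leibniz {i j l} h h₁ h₂ a m := by
    obtain ⟨m, rfl⟩ := QuotientAddGroup.mk_surjective m
    have := congrArg (QuotientAddGroup.mk (s := N (l + 1))) (M.leibniz h h₁ h₂ a m)
    rw [Units.smul_def] at this ⊢
    exact this
  d_d h m := by
    obtain ⟨m, rfl⟩ := QuotientAddGroup.mk_surjective m
    exact congrArg _ (M.d_d h m)

theorem act_mem_range_scal (M : CDGModule.{u, v, w} E) (r : R) {i j l : ℤ} (h : i + j = l)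
    (a : A i) (m : M.X j) (hm : m ∈ (M.scal r j).range) : M.act h a m ∈ (M.scal r l).range := by
  obtain ⟨m, rfl⟩ := hm
  exact ⟨M.act h a m, (M.act_scal r h a m).symm⟩

theorem d_mem_range_scal (M : CDGModule.{u, v, w} E) (r : R) (i : ℤ) (m : M.X i)
    (hm : m ∈ (M.scal r i).range) : M.d i m ∈ (M.scal r (i + 1)).range := by
  obtain ⟨m, rfl⟩ := hm
  exact ⟨M.d i m, (M.d_scal r i m).symm⟩

/-- The cdg submodule `rM` of `M`. -/
def im (r : R) (M : CDGModule.{u, v, w} E) : CDGModule.{u, v, w} E :=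
  M.ofSub (fun i => (M.scal r i).range) (M.act_mem_range_scal r) (M.d_mem_range_scal r)

/-- The quotient cdg module `M / rM`. -/
def coker (r : R) (M : CDGModule.{u, v, w} E) : CDGModule.{u, v, w} E :=
  M.ofQuot (fun i => (M.scal r i).range) (M.act_mem_range_scal r) (M.d_mem_range_scal r)

/-! ### Acyclicity, cones -/

/-- `M` is acyclic: it is an exact complex. -/
def Acyclic (M : CDGModule.{u, v, w} E) : Prop :=
  ∀ i : ℤ, Function.Exact (M.d i) (M.d (i + 1))

/-- The graded piece `tⁱM / tⁱ⁺¹M` of the `t`-adic filtration. -/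
def gr (t : R) (i : ℕ) (M : CDGModule.{u, v, w} E) : CDGModule.{u, v, w} E :=
  (M.im (t ^ i)).coker t

/-- `M` is `n`-acyclic (with respect to `t`): the graded pieces `tⁱM / tⁱ⁺¹M` are acyclic for
`0 ≤ i ≤ n`. -/
def NAcyclic (t : R) (n : ℕ) (M : CDGModule.{u, v, w} E) : Prop :=
  ∀ i ≤ n, (M.gr t i).Acyclic

/-- The cone of a closed morphism `F : M ⟶ N`, with components `Mⁱ⁺¹ ⊕ Nⁱ`. -/
def cone {M N : CDGModule.{u, v, w} E} (F : M ⟶ N) : CDGModule.{u, v, w} E where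
  X i := M.X (i + 1) × N.X i
  act {i j l} h := AddMonoidHom.mk'
    (fun a => AddMonoidHom.mk'
      (fun m => (i.negOnePow • M.act (show i + (j + 1) = l + 1 by omega) a m.1, N.act h a m.2))
      (fun m m' => by simp))
    (fun a b => by ext m <;> simp)
  one_act h m := by
    refine Prod.ext ?_ ?_
    · simp [M.one_act]
    · simp [N.one_act]
  mul_act {i j l ij jl ijl} hij hjl h₁ h₂ a b m := by
    subst hij
    refine Prod.ext ?_ ?_
    · simp only [AddMonoidHom.mk'_apply, Int.negOnePow_add, Units.smul_def, map_zsmul]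
      rw [M.mul_act rfl (show j + (l + 1) = jl + 1 by omega) _
        (show i + (jl + 1) = ijl + 1 by omega)]
      simp [mul_smul]
    · simp [N.mul_act rfl hjl h₁ h₂]
  d i := AddMonoidHom.mk' (fun m => (-M.d (i + 1) m.1, F.f (i + 1) m.1 + N.d i m.2))
    (fun m m' => by
      refine Prod.ext ?_ ?_
      · simp [add_comm]
      · simp only [Prod.fst_add, Prod.snd_add, map_add]
        abel)
  leibniz {i j l} h h₁ h₂ a m := by
    refine Prod.ext ?_ ?_
    · simp only [AddMonoidHom.mk'_apply, Units.smul_def, map_zsmul, Prod.fst_add, Prod.smul_fst,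
        map_neg]
      rw [M.leibniz _ (show (i + 1) + (j + 1) = l + 1 + 1 by omega)
        (show i + (j + 1 + 1) = l + 1 + 1 by omega), Int.negOnePow_succ]
      simp [Units.smul_def]
      abel
    · simp only [AddMonoidHom.mk'_apply, Units.smul_def, map_zsmul, Prod.snd_add, Prod.smul_snd,
        map_add, F.map_act]
      rw [N.leibniz h h₁ h₂]
      simp [Units.smul_def]
      abel
  d_d {i} h m := by
    refine Prod.ext ?_ ?_
    · simp [M.d_d (show 2 + (i + 1) = i + 1 + 1 + 1 by omega), Int.negOnePow_even 2 even_two]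
    · simp [N.d_d h, F.map_d]

end CDGModule

/-! ### The homotopy category and its quotients -/

/-- The homotopy category `Hot(E)` of cdg modules over `E`. -/
abbrev Hot (E : CDGAlgebra R A) :=
  CategoryTheory.Quotient (CDGModule.Homotopic.{u, v, w} (E := E))

/-- The functor from cdg modules and closed morphisms to the homotopy category. -/
abbrev toHot (E : CDGAlgebra R A) : CDGModule.{u, v, w} E ⥤ Hot.{u, v, w} E :=
  CategoryTheory.Quotient.functor _

variable {E : CDGAlgebra R A}

/-- The morphisms of `Hot(E)` whose cone has the property `P`. -/
def coneProp (P : CDGModule.{u, v, w} E → Prop) : MorphismProperty (Hot.{u, v, w} E) :=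
  fun M N f => ∃ F : M.as ⟶ N.as, (toHot E).map F = f ∧ P (CDGModule.cone F)

/-- The Verdier quotient of `Hot(E)` by the full subcategory of the modules with property `P`, that
is, the localization of `Hot(E)` at the morphisms whose cone has property `P`. -/
abbrev VerdierQuotient (P : CDGModule.{u, v, w} E → Prop) := (coneProp P).Localization

/-- The quotient functor, precomposed with the functor to the homotopy category. -/
abbrev toVerdier (P : CDGModule.{u, v, w} E → Prop) :
    CDGModule.{u, v, w} E ⥤ VerdierQuotient P :=
  toHot E ⋙ (coneProp P).Q

/-- The derived category `D(E)` of a dg algebra: the quotient of `Hot(E)` by the acyclic modules. -/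
abbrev DerivedCat (E : DGAlgebra R A) :=
  VerdierQuotient (CDGModule.Acyclic.{u, v, w} (E := E.toCDGAlgebra))

/-- The `n`-derived category `Dⁿ(E)`: the quotient of `Hot(E)` by the `n`-acyclic modules (for the
`t`-adic filtration). -/
abbrev NDerivedCat (E : CDGAlgebra R A) (t : R) (n : ℕ) :=
  VerdierQuotient (CDGModule.NAcyclic.{u, v, w} (E := E) t n)

end Basic

/-! ### Restriction of scalars -/

section Restriction

variable {R : Type u} [CommRing R] {A : ℤ → Type v}
  [∀ i, AddCommGroup (A i)] [∀ i, Module R (A i)]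
  {S : Type u'} [CommRing S] {B : ℤ → Type v'}
  [∀ i, AddCommGroup (B i)] [∀ i, Module S (B i)] {σ : R →+* S}
  {E : CDGAlgebra R A} {F : CDGAlgebra S B}

/-- Restriction of scalars of a cdg module along a morphism of cdg algebras. -/
def CDGModule.res (φ : CDGAlgebraHom σ E F) (M : CDGModule.{u', v', w} F) :
    CDGModule.{u, v, w} E where
  X := M.X
  act h := (M.act h).comp (φ.toFun _).toAddMonoidHom
  one_act h m := by simp [φ.map_one, M.one_act]
  mul_act hij hjl h₁ h₂ a b m := by simp [φ.map_mul, M.mul_act hij hjl h₁ h₂]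
  d := M.d
  leibniz h h₁ h₂ a m := by simp [φ.map_d, M.leibniz h h₁ h₂]
  d_d h m := by simp [φ.map_curv, M.d_d h]

/-- The restriction functor on cdg modules and closed morphisms. -/
def resFunctor (φ : CDGAlgebraHom σ E F) : CDGModule.{u', v', w} F ⥤ CDGModule.{u, v, w} E where
  obj M := M.res φ
  map G :=
    { f := G.f
      map_act := fun h a m => G.map_act h (φ.toFun _ a) m
      map_d := fun m => G.map_d m }

/-- The restriction functor on homotopy categories. -/
def resHot (φ : CDGAlgebraHom σ E F) : Hot.{u', v', w} F ⥤ Hot.{u, v, w} E :=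
  CategoryTheory.Quotient.lift _ (resFunctor φ ⋙ toHot E) (by
    rintro M N G G' ⟨s, hs, hs'⟩
    exact CategoryTheory.Quotient.sound _ ⟨s, fun h h' a m => hs h h' (φ.toFun _ a) m, hs'⟩)

theorem resHot_coneProp (φ : CDGAlgebraHom σ E F)
    {P : CDGModule.{u', v', w} F → Prop} {P' : CDGModule.{u, v, w} E → Prop}
    (hP : ∀ M, P M → P' (M.res φ)) :
    (coneProp P).IsInvertedBy (resHot φ ⋙ (coneProp P').Q) := by
  rintro M N f ⟨G, rfl, hG⟩
  exact (coneProp P').Q_inverts _ ⟨(resFunctor φ).map G, rfl, hP _ hG⟩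

/-- The functor induced by restriction of scalars on Verdier quotients, if restriction of scalars
carries modules with property `P` to modules with property `P'`. -/
def resVerdier (φ : CDGAlgebraHom σ E F)
    {P : CDGModule.{u', v', w} F → Prop} {P' : CDGModule.{u, v, w} E → Prop}
    (hP : ∀ M, P M → P' (M.res φ)) : VerdierQuotient P ⥤ VerdierQuotient P' :=
  Localization.Construction.lift (resHot φ ⋙ (coneProp P').Q) (resHot_coneProp φ hP)

theorem CDGModule.res_scal (φ : CDGAlgebraHom σ E F) (M : CDGModule.{u', v', w} F) (r : R)
    (i : ℤ) : (M.res φ).scal r i = M.scal (σ r) i := by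
  ext m
  change M.act _ (φ.toFun 0 (r • E.one)) m = M.act _ (σ r • F.one) m
  rw [map_smulₛₗ, φ.map_one]

theorem CDGModule.acyclic_iff_of_equiv {M : CDGModule.{u, v, w} E} {N : CDGModule.{u', v', w} F}
    (e : ∀ i, M.X i ≃+ N.X i) (he : ∀ i m, e (i + 1) (M.d i m) = N.d i (e i m)) :
    M.Acyclic ↔ N.Acyclic := by
  refine forall_congr' fun i => ?_
  exact (Function.Exact.iff_of_ladder_addEquiv (e₁ := e i) (e₂ := e (i + 1)) (e₃ := e (i + 1 + 1))
    (AddMonoidHom.ext fun m => (he i m).symm)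
    (AddMonoidHom.ext fun m => (he (i + 1) m).symm)).symm

/-- If `(σ t) ^ (p + 1)` vanishes in `F`, restriction of scalars carries `p`-acyclic
modules to `q`-acyclic modules, for all `q`. -/
theorem CDGModule.NAcyclic.res (φ : CDGAlgebraHom σ E F) {t : R} {p q : ℕ}
    (h0 : (σ t) ^ (p + 1) • F.one = 0) {M : CDGModule.{u', v', w} F}
    (hM : M.NAcyclic (σ t) p) : (M.res φ).NAcyclic t q := by
  intro i _
  have hr : ∀ j, ((M.res φ).scal (t ^ i) j).range = (M.scal ((σ t) ^ i) j).range := fun j => by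
    rw [M.res_scal φ, map_pow]
    rfl
  by_cases hip : i ≤ p
  · let e : ∀ j, ((M.res φ).im (t ^ i)).X j ≃+ (M.im ((σ t) ^ i)).X j :=
      fun j => AddEquiv.addSubgroupCongr (hr j)
    have he : ∀ j x, e j (((M.res φ).im (t ^ i)).scal t j x) =
        (M.im ((σ t) ^ i)).scal (σ t) j (e j x) := fun j x => by
      refine Subtype.ext ?_
      change (M.res φ).scal t j x.1 = M.scal (σ t) j x.1
      rw [M.res_scal φ]
      rfl
    refine (CDGModule.acyclic_iff_of_equiv (M := (M.res φ).gr t i) (N := M.gr (σ t) i)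
      (fun j => QuotientAddGroup.congr _ _ (e j) ?_) ?_).2 (hM i hip)
    · ext y
      constructor
      · rintro ⟨_, ⟨x, rfl⟩, rfl⟩
        exact ⟨e j x, (he j x).symm⟩
      · rintro ⟨x, rfl⟩
        exact ⟨_, ⟨(e j).symm x, rfl⟩, by
          change e j _ = _
          rw [he, AddEquiv.apply_symm_apply]⟩
    · intro j m
      obtain ⟨m, rfl⟩ := QuotientAddGroup.mk_surjective m
      rfl
  · have h1 : ∀ j (x : ((M.res φ).gr t i).X j), x = 0 := by
      intro j x
      obtain ⟨⟨x, hx⟩, rfl⟩ := QuotientAddGroup.mk_surjective x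
      have hx0 : x = 0 := by
        replace hx : x ∈ ((M.res φ).scal (t ^ i) j).range := hx
        rw [hr] at hx
        obtain ⟨y, rfl⟩ := hx
        obtain ⟨c, rfl⟩ : ∃ c, i = c + (p + 1) := ⟨i - (p + 1), by omega⟩
        unfold CDGModule.scal
        rw [pow_add, mul_smul, h0]
        simp
        rfl
      subst hx0
      rfl
    intro j x
    rw [h1 _ x]
    exact ⟨fun _ => ⟨0, map_zero _⟩, fun _ => map_zero _⟩

/-- If `r` acts by zero, acyclic modules are `0`-acyclic. -/
theorem CDGModule.Acyclic.nAcyclic_zero {r : R} (h0 : r • E.one = 0) {M : CDGModule.{u, v, w} E}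
    (hM : M.Acyclic) : M.NAcyclic r 0 := by
  intro i hi
  obtain rfl : i = 0 := by omega
  have hz : ∀ j x, M.scal r j x = 0 := fun j x => by simp [CDGModule.scal, h0]
  have h1 : ∀ j, (M.scal (r ^ 0) j).range = ⊤ := fun j => by
    rw [AddMonoidHom.range_eq_top]
    exact fun x => ⟨x, by rw [pow_zero, M.scal_one]⟩
  have h2 : ∀ j, ((M.im (r ^ 0)).scal r j).range = ⊥ := fun j => by
    rw [eq_bot_iff]
    rintro _ ⟨x, rfl⟩
    exact Subtype.ext (hz j x.1)
  let e : ∀ j, (M.gr r 0).X j ≃+ M.X j := fun j =>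
    ((QuotientAddGroup.quotientAddEquivOfEq (h2 j)).trans QuotientAddGroup.quotientBot).trans
      ((AddEquiv.addSubgroupCongr (h1 j)).trans AddSubgroup.topEquiv)
  refine (CDGModule.acyclic_iff_of_equiv e ?_).2 hM
  intro j m
  obtain ⟨m, rfl⟩ := QuotientAddGroup.mk_surjective m
  rfl

end Restriction

/-! ### Deformations -/

/-- The ring `Rₙ = k[t]/(tⁿ⁺¹)`. -/
abbrev TruncPoly (k : Type u) [CommRing k] (n : ℕ) :=
  k[X] ⧸ Ideal.span {(Polynomial.X : k[X]) ^ (n + 1)}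

namespace TruncPoly

variable (k : Type u) [CommRing k] (n : ℕ)

/-- The class of the variable. -/
def t : TruncPoly k n := Ideal.Quotient.mk _ Polynomial.X

/-- The reduction `Rₙ → k`, `t ↦ 0`. -/
def aug : TruncPoly k n →ₐ[k] k :=
  Ideal.Quotient.liftₐ _ (Polynomial.aeval (0 : k)) (fun a ha => by
    obtain ⟨b, rfl⟩ := Ideal.mem_span_singleton'.1 ha
    simp)

theorem aug_t : aug k n (t k n) = 0 := by
  change Polynomial.aeval (0 : k) Polynomial.X = 0
  simp

theorem t_pow : t k n ^ (n + 1) = 0 := by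
  rw [t, ← map_pow, Ideal.Quotient.eq_zero_iff_mem]
  exact Ideal.mem_span_singleton_self _

end TruncPoly

section Deformation

variable {k : Type u} [CommRing k] {A : ℤ → Type v}
  [∀ i, AddCommGroup (A i)] [∀ i, Module k (A i)]

/-- The reduction modulo `t`, `Rₙ ⊗ Aⁱ → Aⁱ`, `f ⊗ a ↦ f(0) a`, linear over `Rₙ → k`. -/
def redMap (A : ℤ → Type v) [∀ i, AddCommGroup (A i)] [∀ i, Module k (A i)] (n : ℕ) (i : ℤ) :
    (TruncPoly k n ⊗[k] A i) →ₛₗ[(TruncPoly.aug k n : TruncPoly k n →+* k)] A i where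
  toFun := TensorProduct.lift ((LinearMap.lsmul k (A i)).comp (TruncPoly.aug k n).toLinearMap)
  map_add' := map_add _
  map_smul' r x := by
    induction x using TensorProduct.induction_on with
    | zero => simp
    | tmul s a => simp [TensorProduct.smul_tmul', mul_smul]
    | add x y hx hy => rw [smul_add, map_add, map_add, smul_add, hx, hy]

theorem redMap_tmul (n : ℕ) (i : ℤ) (r : TruncPoly k n) (a : A i) :
    redMap A n i (r ⊗ₜ a) = TruncPoly.aug k n r • a := rfl

/-- A cdg deformation of order `n` of the dg algebra `A`: a structure of cdg `Rₙ`-algebra on the graded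
`Rₙ`-module `Rₙ ⊗ A = A[t]/(tⁿ⁺¹)` which reduces modulo `t` to the dg algebra structure of `A`. -/
structure CDGDeformation (dA : DGAlgebra k A) (n : ℕ) extends
    CDGAlgebra (TruncPoly k n) (fun i => TruncPoly k n ⊗[k] A i) where
  red_mul {i j l : ℤ} (h : i + j = l) (a : TruncPoly k n ⊗[k] A i) (b : TruncPoly k n ⊗[k] A j) :
    redMap A n l (mul h a b) = dA.mul h (redMap A n i a) (redMap A n j b)
  red_one : redMap A n 0 one = dA.one
  red_d {i : ℤ} (a : TruncPoly k n ⊗[k] A i) : redMap A n (i + 1) (d i a) = dA.d i (redMap A n i a)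
  red_curv : redMap A n 2 curv = 0

namespace CDGDeformation

variable {dA : DGAlgebra k A} {n : ℕ} (E : CDGDeformation dA n)

/-- The cdg algebra `Aₘ = Aₙ / tᵐ⁺¹Aₙ`.  (Its modules, for the action of `Rₙ`, on which `tᵐ⁺¹`
vanishes, are the same as for the action of `Rₘ`.) -/
abbrev level (m : ℕ) :=
  E.toCDGAlgebra.quot (TruncPoly.t k n ^ (m + 1))

/-- The morphism `A₀ → A`. -/
def levelZeroHom : CDGAlgebraHom (TruncPoly.aug k n : TruncPoly k n →+* k)
    (E.level 0) dA.toCDGAlgebra where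
  toFun i := Submodule.liftQ _ (redMap A n i) (by
    rintro _ ⟨x, rfl⟩
    rw [LinearMap.mem_ker, LinearMap.lsmul_apply, map_smulₛₗ, zero_add, pow_one]
    simp [TruncPoly.aug_t])
  map_mul h a b := by
    obtain ⟨a, rfl⟩ := Submodule.Quotient.mk_surjective _ a
    obtain ⟨b, rfl⟩ := Submodule.Quotient.mk_surjective _ b
    exact E.red_mul h a b
  map_one := E.red_one
  map_d a := by
    obtain ⟨a, rfl⟩ := Submodule.Quotient.mk_surjective _ a
    exact E.red_d a
  map_curv := E.red_curv.trans dA.curv_eq_zero.symm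

/-- The functor `D(A) → D⁰(A₀)` given by restriction of scalars along `A₀ → A`. -/
def derivedToLevelZero :
    DerivedCat.{u, v, w} dA ⥤ NDerivedCat.{u, max u v, w} (E.level 0) (TruncPoly.t k n) 0 :=
  resVerdier E.levelZeroHom (fun _ hM => by
    have h : (TruncPoly.aug k n : TruncPoly k n →+* k) (TruncPoly.t k n) = 0 :=
      TruncPoly.aug_t k n
    refine CDGModule.NAcyclic.res (p := 0) E.levelZeroHom ?_ ?_
    · rw [h]; simp
    · rw [h]; exact hM.nAcyclic_zero (by simp))

/-- The functor `Dᵐ(Aₘ) → Dᵐ⁺¹(Aₘ₊₁)` induced by the forgetful functor, i.e. restriction of scalars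
along `Aₘ₊₁ → Aₘ`. -/
def levelIota (m : ℕ) :
    NDerivedCat.{u, max u v, w} (E.level m) (TruncPoly.t k n) m ⥤
      NDerivedCat.{u, max u v, w} (E.level (m + 1)) (TruncPoly.t k n) (m + 1) :=
  resVerdier (E.toCDGAlgebra.quotFactor (pow_dvd_pow _ (by omega)))
    (fun _ hM => CDGModule.NAcyclic.res _ (E.toCDGAlgebra.quot_smul_one _) hM)

/-- The functor `Dᵐ(Aₘ) → Dⁿ(Aₙ)` induced by the forgetful functor, i.e. restriction of scalars
along `Aₙ → Aₘ`. -/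
def iota (m : ℕ) :
    NDerivedCat.{u, max u v, w} (E.level m) (TruncPoly.t k n) m ⥤
      NDerivedCat.{u, max u v, w} E.toCDGAlgebra (TruncPoly.t k n) n :=
  resVerdier (E.toCDGAlgebra.quotProj _)
    (fun _ hM => CDGModule.NAcyclic.res _ (E.toCDGAlgebra.quot_smul_one _) hM)

end CDGDeformation

end Deformation

end

/-! Let `φ : E → F = E / sE` be a quotient map with `s = t ^ (p + 1)`. Restriction of scalars along
`φ` has the left adjoint `M ↦ M / sM` already on closed morphisms, and its counit `N / sN → N` is an
isomorphism. The adjunction passes to homotopy categories, and then to Verdier quotients as soon as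
both functors respect the localized morphisms; no resolutions or derived functors are needed. The
counit remains invertible, so restriction is fully faithful (`resVerdier_fullyFaithful`).

The point to check is that reduction respects `q`-acyclic cones. Reduction commutes with cones, and
passing from `C` to `C / t ^ (p + 1) C` keeps the graded pieces of index at most `p` and kills the
others (`nAcyclic_of_surjective`).

For the essential image, take `q = p + 1`. The cone of `M → M / t ^ (p + 1) M` has acyclic graded
pieces for `i ≤ p`, and for `i = p + 1` its piece is a shift of `t ^ (p + 1) M`, because `t ^ (p +
2) = 0`. So acyclicity of `t ^ (p + 1) M` makes `M` isomorphic to a restriction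
(`nAcyclic_cone_toReduction`). Conversely, the cohomology of `t ^ q M` is a functor on the homotopy
category which inverts morphisms with `q`-acyclic cone, and it vanishes on restrictions
(`im_acyclic_of_iso`).

The comparison of `D(A)` with the bottom level is the case `p = q = 0`, where the condition on the
essential image is empty. -/

noncomputable section

/-! ### Adjunctions and quotient categories -/

section QuotientAdjunction

universe v₁ v₂ u₁ u₂

variable {C : Type u₁} [Category.{v₁} C] {D : Type u₂} [Category.{v₂} D]
  {G : C ⥤ D} {F : D ⥤ C}

/-- An adjunction between functors which preserve relations on the morphisms descends to the
quotient categories. -/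
def CategoryTheory.Adjunction.quotient (adj : G ⊣ F) (r : HomRel C) (r' : HomRel D)
    (hG : ∀ (X Y : C) (f g : X ⟶ Y), r f g →
      (G ⋙ Quotient.functor r').map f = (G ⋙ Quotient.functor r').map g)
    (hF : ∀ (X Y : D) (f g : X ⟶ Y), r' f g →
      (F ⋙ Quotient.functor r).map f = (F ⋙ Quotient.functor r).map g) :
    Quotient.lift r (G ⋙ Quotient.functor r') hG ⊣
      Quotient.lift r' (F ⋙ Quotient.functor r) hF :=
  Adjunction.mkOfUnitCounit
    { unit := Quotient.natTransLift r
        (F := 𝟭 _) (G := Quotient.lift r (G ⋙ Quotient.functor r') hG ⋙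
          Quotient.lift r' (F ⋙ Quotient.functor r) hF)
        { app := fun X => (Quotient.functor r).map (adj.unit.app X)
          naturality := fun X Y f => by
            change (Quotient.functor r).map f ≫ _ =
              _ ≫ (Quotient.functor r).map (F.map (G.map f))
            rw [← Functor.map_comp, ← Functor.map_comp]
            exact congrArg _ (adj.unit.naturality f) }
      counit := Quotient.natTransLift r'
        (F := Quotient.lift r' (F ⋙ Quotient.functor r) hF ⋙
          Quotient.lift r (G ⋙ Quotient.functor r') hG) (G := 𝟭 _)
        { app := fun X => (Quotient.functor r').map (adj.counit.app X)
          naturality := fun X Y f => by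
            change (Quotient.functor r').map (G.map (F.map f)) ≫ _ =
              _ ≫ (Quotient.functor r').map f
            rw [← Functor.map_comp, ← Functor.map_comp]
            exact congrArg _ (adj.counit.naturality f) }
      left_triangle := by
        apply Quotient.natTrans_ext
        ext X
        -- The identity in the middle is the component of the associator in the triangle identity.
        change (Quotient.functor r').map (G.map (adj.unit.app X)) ≫ 𝟙 _ ≫
          (Quotient.functor r').map (adj.counit.app (G.obj X)) = 𝟙 _
        rw [Category.id_comp, ← Functor.map_comp]
        exact (congrArg _ (adj.left_triangle_components X)).trans (Functor.map_id _ _)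
      right_triangle := by
        apply Quotient.natTrans_ext
        ext X
        change (Quotient.functor r).map (adj.unit.app (F.obj X)) ≫ 𝟙 _ ≫
          (Quotient.functor r).map (F.map (adj.counit.app X)) = 𝟙 _
        rw [Category.id_comp, ← Functor.map_comp]
        exact (congrArg _ (adj.right_triangle_components X)).trans (Functor.map_id _ _) }

end QuotientAdjunction

section

variable {R : Type u} [CommRing R] {A : ℤ → Type v}
  [∀ i, AddCommGroup (A i)] [∀ i, Module R (A i)]
  {S : Type u'} [CommRing S] {B : ℤ → Type v'}
  [∀ i, AddCommGroup (B i)] [∀ i, Module S (B i)] {σ : R →+* S}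
  {E : CDGAlgebra R A} {F : CDGAlgebra S B}

namespace CDGModule

theorem act_smul (M : CDGModule.{u, v, w} E) (r : R) {i j l : ℤ} (h : i + j = l)
    (a : A i) (m : M.X j) : M.act h (r • a) m = M.scal r l (M.act h a m) := by
  unfold scal
  rw [← M.mul_act (zero_add i) h h (zero_add l), map_smul (E.mul _),
    LinearMap.smul_apply, E.one_mul]

theorem Hom.map_scal {M N : CDGModule.{u, v, w} E} (G : M ⟶ N) (r : R) {j : ℤ} (m : M.X j) :
    G.f j (M.scal r j m) = N.scal r j (G.f j m) :=
  G.map_act _ _ m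

theorem coker_scal_mk (M : CDGModule.{u, v, w} E) (s r : R) {j : ℤ} (m : M.X j) :
    (M.coker s).scal r j (QuotientAddGroup.mk m) = QuotientAddGroup.mk (M.scal r j m) := rfl

theorem coker_scal (M : CDGModule.{u, v, w} E) (s : R) (j : ℤ) (m : (M.coker s).X j) :
    (M.coker s).scal s j m = 0 := by
  obtain ⟨m, rfl⟩ := QuotientAddGroup.mk_surjective m
  rw [coker_scal_mk]
  exact (QuotientAddGroup.eq_zero_iff _).2 ⟨m, rfl⟩

end CDGModule

/-! ### Extension of scalars along a quotient map -/

/-- The morphism `φ : E → F` is surjective with kernel `sE`. -/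
structure CDGAlgebraHom.IsQuotientMap (φ : CDGAlgebraHom σ E F) (s : R) : Prop where
  surjective (i : ℤ) : Function.Surjective (φ.toFun i)
  mem_of_eq_zero {i : ℤ} (a : A i) : φ.toFun i a = 0 → a ∈ scalarSubmodule A s i
  smul_one : σ s • F.one = 0

namespace CDGModule

variable {φ : CDGAlgebraHom σ E F} {s : R} (hφ : φ.IsQuotientMap s)

include hφ in
-- Since `a - a'` lies in the kernel `sE`, it acts through `s`, hence by zero. This makes the action
-- of `E / sE` well defined.
theorem act_eq_of_map_eq (N : CDGModule.{u, v, w} E) (hN : ∀ j x, N.scal s j x = 0)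
    {i j l : ℤ} (h : i + j = l) {a a' : A i} (haa : φ.toFun i a = φ.toFun i a') :
    N.act h a = N.act h a' := by
  obtain ⟨c, hc⟩ := hφ.mem_of_eq_zero (a - a') (by rw [map_sub, haa, sub_self])
  rw [← sub_eq_zero, ← map_sub, ← hc]
  ext m
  change N.act h (s • c) m = 0
  rw [act_smul, hN]

/-- The `F`-module given by an `E`-module on which `s` acts by zero, if `F = E / sE`. -/
def desc (N : CDGModule.{u, v, w} E) (hN : ∀ j x, N.scal s j x = 0) :
    CDGModule.{u', v', w} F :=
  -- Elements of `F` act through chosen preimages. The choice does not affect the action, so every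
  -- axiom is checked on lifts to `E`.
  have key : ∀ {i j l : ℤ} (h : i + j = l) (a : A i),
      N.act h (Function.surjInv (hφ.surjective i) (φ.toFun i a)) = N.act h a := fun h a =>
    N.act_eq_of_map_eq hφ hN h (Function.surjInv_eq (hφ.surjective _) _)
  { X := N.X
    act := fun {i j l} h => AddMonoidHom.mk' (fun b => N.act h (Function.surjInv (hφ.surjective i) b))
      (fun b b' => by
        obtain ⟨a, rfl⟩ := hφ.surjective i b
        obtain ⟨a', rfl⟩ := hφ.surjective i b'
        rw [← map_add, key, key, key, map_add])
    one_act := fun h m => by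
      rw [← φ.map_one]
      change N.act h _ m = m
      rw [key, N.one_act]
    mul_act := fun {i j l ij jl ijl} hij hjl h₁ h₂ b b' m => by
      obtain ⟨a, rfl⟩ := hφ.surjective i b
      obtain ⟨a', rfl⟩ := hφ.surjective j b'
      rw [← φ.map_mul]
      change N.act h₁ _ m = N.act h₂ _ (N.act hjl _ m)
      rw [key, key, key, N.mul_act]
    d := N.d
    leibniz := fun {i j l} h h₁ h₂ b m => by
      obtain ⟨a, rfl⟩ := hφ.surjective i b
      rw [← φ.map_d]
      change N.d l (N.act h _ m) = N.act h₁ _ m + i.negOnePow • N.act h₂ _ (N.d j m)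
      rw [key, key, key, N.leibniz]
    d_d := fun {i} h m => by
      rw [← φ.map_curv]
      change N.d (i + 1) (N.d i m) = N.act h _ m
      rw [key, N.d_d] }

theorem desc_act (N : CDGModule.{u, v, w} E) (hN : ∀ j x, N.scal s j x = 0) {i j l : ℤ}
    (h : i + j = l) (a : A i) (m : N.X j) :
    (N.desc hφ hN).act h (φ.toFun i a) m = N.act h a m :=
  DFunLike.congr_fun (N.act_eq_of_map_eq hφ hN h (Function.surjInv_eq (hφ.surjective _) _)) m

end CDGModule

/-! ### The reduction `M / sM` -/

section

variable {φ : CDGAlgebraHom σ E F} {s : R} (hφ : φ.IsQuotientMap s)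

namespace CDGModule

/-- The `E / sE`-module `M / sM`. -/
def red (M : CDGModule.{u, v, w} E) : CDGModule.{u', v', w} F :=
  (M.coker s).desc hφ (M.coker_scal s)

/-- The projection `M → M / sM`. -/
def redMk (M : CDGModule.{u, v, w} E) (j : ℤ) : M.X j →+ (M.red hφ).X j :=
  QuotientAddGroup.mk' (M.scal s j).range

theorem redMk_surjective (M : CDGModule.{u, v, w} E) (j : ℤ) :
    Function.Surjective (M.redMk hφ j) :=
  QuotientAddGroup.mk'_surjective _

theorem redMk_eq_zero_iff (M : CDGModule.{u, v, w} E) {j : ℤ} (m : M.X j) :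
    M.redMk hφ j m = 0 ↔ ∃ m', M.scal s j m' = m :=
  QuotientAddGroup.eq_zero_iff _

theorem red_act (M : CDGModule.{u, v, w} E) {i j l : ℤ} (h : i + j = l) (a : A i) (m : M.X j) :
    (M.red hφ).act h (φ.toFun i a) (M.redMk hφ j m) = M.redMk hφ l (M.act h a m) :=
  desc_act hφ (M.coker s) (M.coker_scal s) h a (M.redMk hφ j m)

theorem red_d (M : CDGModule.{u, v, w} E) (j : ℤ) (m : M.X j) :
    (M.red hφ).d j (M.redMk hφ j m) = M.redMk hφ (j + 1) (M.d j m) := rfl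

/-- The map `M / sM → Y` induced by a map `M → Y` which vanishes on `sM`. -/
def redLift (M : CDGModule.{u, v, w} E) {j : ℤ} {Y : Type w} [AddCommGroup Y] (f : M.X j →+ Y)
    (hf : ∀ m, f (M.scal s j m) = 0) : (M.red hφ).X j →+ Y :=
  QuotientAddGroup.lift (M.scal s j).range f (by
    rintro _ ⟨x, rfl⟩
    exact hf x)

theorem redLift_mk (M : CDGModule.{u, v, w} E) {j : ℤ} {Y : Type w} [AddCommGroup Y]
    (f : M.X j →+ Y) (hf : ∀ m, f (M.scal s j m) = 0) (m : M.X j) :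
    M.redLift hφ f hf (M.redMk hφ j m) = f m := rfl

theorem redMk_scal (M : CDGModule.{u, v, w} E) {j : ℤ} (m : M.X j) :
    M.redMk hφ j (M.scal s j m) = 0 :=
  (M.redMk_eq_zero_iff hφ _).2 ⟨m, rfl⟩

theorem hom_red_ext (M : CDGModule.{u, v, w} E) {N : CDGModule.{u', v', w} F}
    {G G' : M.red hφ ⟶ N} (h : ∀ i m, G.f i (M.redMk hφ i m) = G'.f i (M.redMk hφ i m)) :
    G = G' := by
  apply CDGModule.Hom.ext
  funext i
  ext m
  obtain ⟨m, rfl⟩ := M.redMk_surjective hφ i m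
  exact h i m

end CDGModule

end

/-- The functor `M ↦ M / sM` from `E`-modules to `E / sE`-modules. -/
def reduction {φ : CDGAlgebraHom σ E F} {s : R} (hφ : φ.IsQuotientMap s) :
    CDGModule.{u, v, w} E ⥤ CDGModule.{u', v', w} F where
  obj M := M.red hφ
  map {M N} G :=
    { f := fun i => M.redLift hφ ((N.redMk hφ i).comp (G.f i)) (fun m => by
        rw [AddMonoidHom.comp_apply, CDGModule.Hom.map_scal, N.redMk_scal])
      map_act := fun {i j l} h b m => by
        obtain ⟨a, rfl⟩ := hφ.surjective i b
        obtain ⟨m, rfl⟩ := M.redMk_surjective hφ j m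
        rw [CDGModule.red_act, CDGModule.redLift_mk, CDGModule.redLift_mk,
          AddMonoidHom.comp_apply, AddMonoidHom.comp_apply, CDGModule.red_act, G.map_act]
      map_d := fun {i} m => by
        obtain ⟨m, rfl⟩ := M.redMk_surjective hφ i m
        rw [CDGModule.red_d, CDGModule.redLift_mk, CDGModule.redLift_mk,
          AddMonoidHom.comp_apply, AddMonoidHom.comp_apply, CDGModule.red_d, G.map_d] }
  map_id M := CDGModule.hom_red_ext hφ M (fun _ _ => rfl)
  map_comp {M _ _} _ _ := CDGModule.hom_red_ext hφ M (fun _ _ => rfl)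

section

variable {φ : CDGAlgebraHom σ E F} {s : R} (hφ : φ.IsQuotientMap s)

/-- The projection `M → M / sM`. -/
def toReduction (M : CDGModule.{u, v, w} E) :
    M ⟶ (resFunctor φ).obj ((reduction hφ).obj M) where
  f := M.redMk hφ
  map_act h a m := (M.red_act hφ h a m).symm
  map_d _ := rfl

include hφ in
theorem res_scal_eq_zero (N : CDGModule.{u', v', w} F) (j : ℤ) (m : N.X j) :
    (N.res φ).scal s j m = 0 := by
  rw [CDGModule.res_scal]
  change N.act _ (σ s • F.one) m = 0
  rw [hφ.smul_one, map_zero]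
  rfl

/-- The isomorphism `N / sN ≅ N`. -/
def reductionRes (N : CDGModule.{u', v', w} F) :
    (reduction hφ).obj ((resFunctor φ).obj N) ≅ N where
  hom :=
    { f := fun i => (N.res φ).redLift hφ (AddMonoidHom.id (N.X i)) (res_scal_eq_zero hφ N i)
      map_act := fun {i j l} h b m => by
        obtain ⟨a, rfl⟩ := hφ.surjective i b
        obtain ⟨m, rfl⟩ := (N.res φ).redMk_surjective hφ j m
        exact congrArg _ ((N.res φ).red_act hφ h a m)
      map_d := fun {i} m => by
        obtain ⟨m, rfl⟩ := (N.res φ).redMk_surjective hφ i m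
        rfl }
  inv :=
    { f := (N.res φ).redMk hφ
      map_act := fun {i j l} h b m => by
        obtain ⟨a, rfl⟩ := hφ.surjective i b
        exact ((N.res φ).red_act hφ h a m).symm
      map_d := fun m => rfl }
  hom_inv_id := CDGModule.hom_red_ext hφ (N.res φ) (fun _ _ => rfl)
  inv_hom_id := rfl

/-- Reduction modulo `s` is left adjoint to restriction of scalars. -/
def reductionAdjunction :
    reduction.{u, u', v, v', w} hφ ⊣ resFunctor φ :=
  Adjunction.mkOfUnitCounit
    { unit := { app := fun M => toReduction hφ M
                naturality := fun _ _ _ => CDGModule.Hom.ext rfl }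
      counit := { app := fun N => (reductionRes hφ N).hom
                  naturality := fun N _ _ =>
                    CDGModule.hom_red_ext hφ (N.res φ) (fun _ _ => rfl) }
      left_triangle := by
        ext M
        exact CDGModule.hom_red_ext hφ M (fun _ _ => rfl)
      right_triangle := by
        ext M
        rfl }

/-- A homotopy commutes with `s`, which acts through degree `0` and so produces no sign; it
therefore descends to the quotients by `s`. -/
theorem reduction_map_homotopic {M N : CDGModule.{u, v, w} E} (G G' : M ⟶ N)
    (h : CDGModule.Homotopic G G') :
    CDGModule.Homotopic ((reduction hφ).map G) ((reduction hφ).map G') := by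
  obtain ⟨p, hp, hp'⟩ := h
  have hs : ∀ i m, p i (M.scal s (i + 1) m) = N.scal s i (p i m) := fun i m => by
    have := hp (zero_add i) (zero_add (i + 1)) (s • E.one) m
    rwa [Int.negOnePow_zero, one_smul] at this
  refine ⟨fun i => M.redLift hφ ((N.redMk hφ i).comp (p i)) (fun m => ?_), ?_, ?_⟩
  · exact (congrArg (N.redMk hφ i) (hs i m)).trans (N.redMk_scal hφ _)
  · intro i j l h h' b m
    obtain ⟨a, rfl⟩ := hφ.surjective i b
    obtain ⟨m, rfl⟩ := M.redMk_surjective hφ _ m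
    have := congrArg (N.redMk hφ l) (hp h h' a m)
    rw [Units.smul_def, map_zsmul, ← Units.smul_def, ← CDGModule.red_act] at this
    refine Eq.trans (congrArg _ (M.red_act hφ h' a m)) this
  · intro i m
    obtain ⟨m, rfl⟩ := M.redMk_surjective hφ _ m
    have := congrArg (N.redMk hφ (i + 1)) (hp' i m)
    rw [map_sub, map_add] at this
    exact this

/-- Reduction modulo `s` on homotopy categories. -/
def reductionHot : Hot.{u, v, w} E ⥤ Hot.{u', v', w} F :=
  CategoryTheory.Quotient.lift _ (reduction hφ ⋙ toHot F) (fun _ _ G G' h =>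
    CategoryTheory.Quotient.sound _ (reduction_map_homotopic hφ G G' h))

/-- The adjunction between reduction modulo `s` and restriction of scalars on homotopy
categories. -/
def reductionHotAdjunction : reductionHot.{u, u', v, v', w} hφ ⊣ resHot φ :=
  (reductionAdjunction hφ).quotient _ _ _ _

instance : IsIso (reductionHotAdjunction.{u, u', v, v', w} hφ).counit := by
  have : ∀ N, IsIso ((reductionHotAdjunction.{u, u', v, v', w} hφ).counit.app N) := fun N =>
    ((toHot F).mapIso (reductionRes hφ N.as)).isIso_hom
  exact NatIso.isIso_of_isIso_app _

/-! ### Passage to the Verdier quotients -/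

variable {P : CDGModule.{u', v', w} F → Prop} {P' : CDGModule.{u, v, w} E → Prop}
  (hP : ∀ M, P M → P' (M.res φ))

theorem toVerdier_comp_resVerdier :
    (coneProp P).Q ⋙ resVerdier φ hP = resHot φ ⋙ (coneProp P').Q :=
  Localization.Construction.fac _ _

include hφ in
/-- If reduction modulo `s` inverts the morphisms whose cone has property `P'`, restriction of
scalars is fully faithful on Verdier quotients. -/
theorem resVerdier_fullyFaithful
    (hL : ∀ {M N : CDGModule.{u, v, w} E} (G : M ⟶ N), P' (CDGModule.cone G) →
      P (CDGModule.cone ((reduction hφ).map G))) :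
    (resVerdier φ hP).Full ∧ (resVerdier φ hP).Faithful := by
  have hL' : (coneProp P').IsInvertedBy (reductionHot hφ ⋙ (coneProp P).Q) := by
    rintro M N f ⟨G, rfl, hG⟩
    exact (coneProp P).Q_inverts _ ⟨(reduction hφ).map G, rfl, hL _ hG⟩
  let L' : VerdierQuotient P' ⥤ VerdierQuotient P := Localization.Construction.lift _ hL'
  let : CatCommSq (reductionHot hφ) (coneProp P').Q (coneProp P).Q L' :=
    ⟨eqToIso (Localization.Construction.fac _ hL').symm⟩
  let : CatCommSq (resHot φ) (coneProp P).Q (coneProp P').Q (resVerdier φ hP) :=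
    ⟨eqToIso (toVerdier_comp_resVerdier hP).symm⟩
  -- Both functors descend to the localizations, and the adjunction follows formally.
  let adj := (reductionHotAdjunction hφ).localization (coneProp P').Q (coneProp P')
    (coneProp P).Q (coneProp P) L' (resVerdier φ hP)
  have h1 : ∀ N, IsIso (adj.counit.app N) := fun N => by
    -- Localizing does not change the objects, so it suffices to treat the image of `N`, where the
    -- localized counit is built from the counit on homotopy categories.
    obtain ⟨N, rfl⟩ := (Localization.Construction.objEquiv (coneProp P)).surjective N
    change IsIso (adj.counit.app ((coneProp P).Q.obj N))
    rw [Adjunction.localization_counit_app]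
    infer_instance
  have : IsIso adj.counit := NatIso.isIso_of_isIso_app _
  exact ⟨adj.fullyFaithfulROfIsIsoCounit.full, adj.fullyFaithfulROfIsIsoCounit.faithful⟩

/-- The module `M` is in the essential image of restriction of scalars if the cone of `M → M / sM`
has property `P'`. -/
theorem essImage_of_cone_toReduction (M : CDGModule.{u, v, w} E)
    (hM : P' (CDGModule.cone (toReduction hφ M))) :
    (resVerdier φ hP).essImage ((toVerdier P').obj M) := by
  have h1 : IsIso ((coneProp P').Q.map ((toHot E).map (toReduction hφ M))) :=
    (coneProp P').Q_inverts _ ⟨toReduction hφ M, rfl, hM⟩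
  exact ⟨(toVerdier P).obj ((reduction hφ).obj M),
    ⟨(eqToIso (toVerdier_comp_resVerdier hP)).app ((toHot F).obj ((reduction hφ).obj M)) ≪≫
      (asIso ((coneProp P').Q.map ((toHot E).map (toReduction hφ M)))).symm⟩⟩

/-- The objects of the essential image of restriction of scalars are isomorphic to restrictions. -/
theorem exists_iso_of_essImage (M : CDGModule.{u, v, w} E)
    (hM : (resVerdier φ hP).essImage ((toVerdier P').obj M)) :
    ∃ N : CDGModule.{u', v', w} F,
      Nonempty ((toVerdier P').obj (N.res φ) ≅ (toVerdier P').obj M) := by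
  obtain ⟨N, ⟨e⟩⟩ := hM
  obtain ⟨N, rfl⟩ := (Localization.Construction.objEquiv (coneProp P)).surjective N
  exact ⟨N.as, ⟨(eqToIso (toVerdier_comp_resVerdier hP)).symm.app N ≪≫ e⟩⟩

end

/-! ### Elementary criteria for acyclicity -/

namespace CDGModule

theorem scal_pow_succ (M : CDGModule.{u, v, w} E) (t : R) (i : ℕ) {j : ℤ} (m : M.X j) :
    M.scal (t ^ (i + 1)) j m = M.scal t j (M.scal (t ^ i) j m) := by
  rw [pow_succ', scal_mul]

theorem scal_pow_eq_zero (M : CDGModule.{u, v, w} E) {t : R} {p i : ℕ} (hpi : p ≤ i) {j : ℤ}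
    (h : ∀ m, M.scal (t ^ p) j m = 0) (m : M.X j) : M.scal (t ^ i) j m = 0 := by
  obtain ⟨c, rfl⟩ := Nat.exists_eq_add_of_le' hpi
  rw [pow_add, scal_mul, h, map_zero]

theorem scal_eq_zero (M : CDGModule.{u, v, w} E) {r : R} (h : r • E.one = 0) (j : ℤ) (m : M.X j) :
    M.scal r j m = 0 := by
  simp [scal, h]

/-- The class of `tⁱm` in `tⁱM / tⁱ⁺¹M`. -/
def grMk (M : CDGModule.{u, v, w} E) (t : R) (i : ℕ) {j : ℤ} (m : M.X j) : (M.gr t i).X j :=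
  QuotientAddGroup.mk (s := ((M.im (t ^ i)).scal t j).range)
    (⟨M.scal (t ^ i) j m, m, rfl⟩ : (M.im (t ^ i)).X j)

theorem grMk_surjective (M : CDGModule.{u, v, w} E) (t : R) (i : ℕ) {j : ℤ}
    (x : (M.gr t i).X j) : ∃ m, M.grMk t i m = x := by
  obtain ⟨⟨_, m, rfl⟩, rfl⟩ := QuotientAddGroup.mk_surjective x
  exact ⟨m, rfl⟩

theorem gr_d_grMk (M : CDGModule.{u, v, w} E) (t : R) (i : ℕ) {j : ℤ} (m : M.X j) :
    (M.gr t i).d j (M.grMk t i m) = M.grMk t i (M.d j m) :=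
  congrArg (QuotientAddGroup.mk (s := ((M.im (t ^ i)).scal t (j + 1)).range))
    (Subtype.ext (M.d_scal (t ^ i) j m))

/-- This replaces computations in the nested subquotient by equations in `M` itself. -/
theorem grMk_eq_iff (M : CDGModule.{u, v, w} E) (t : R) (i : ℕ) {j : ℤ} (m m' : M.X j) :
    M.grMk t i m = M.grMk t i m' ↔
      ∃ z, M.scal (t ^ i) j m' = M.scal (t ^ i) j m + M.scal (t ^ (i + 1)) j z := by
  refine QuotientAddGroup.eq.trans ?_
  constructor
  · rintro ⟨⟨_, z, rfl⟩, hz⟩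
    refine ⟨z, ?_⟩
    rw [scal_pow_succ]
    have : M.scal t j (M.scal (t ^ i) j z) = -M.scal (t ^ i) j m + M.scal (t ^ i) j m' :=
      congrArg Subtype.val hz
    rw [this]
    abel
  · rintro ⟨z, hz⟩
    refine ⟨⟨_, z, rfl⟩, Subtype.ext ?_⟩
    change M.scal t j (M.scal (t ^ i) j z) = -M.scal (t ^ i) j m + M.scal (t ^ i) j m'
    rw [← scal_pow_succ, hz]
    abel

theorem grMk_zero (M : CDGModule.{u, v, w} E) (t : R) (i : ℕ) (j : ℤ) :
    M.grMk t i (0 : M.X j) = 0 := by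
  refine (QuotientAddGroup.eq_zero_iff _).2 ⟨0, Subtype.ext ?_⟩
  change M.scal t j 0 = M.scal (t ^ i) j 0
  rw [map_zero, map_zero]

/-- The square of the differential is the action of the curvature, which is divisible by `t`. Hence
it vanishes on each graded piece. -/
theorem scal_d_d (M : CDGModule.{u, v, w} E) {t : R} (hc : E.curv ∈ scalarSubmodule A t 2)
    (j : ℤ) (m : M.X j) : ∃ m', M.d (j + 1) (M.d j m) = M.scal t (j + 1 + 1) m' := by
  obtain ⟨c, hc⟩ := hc
  refine ⟨M.act (by omega) c m, ?_⟩
  rw [M.d_d (by omega), ← hc]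
  exact M.act_smul t _ c m

/-- The curvature condition makes the graded piece a complex, so only the inclusion of cocycles in
coboundaries remains, written with elements of `M`. -/
theorem gr_acyclic_iff (M : CDGModule.{u, v, w} E) {t : R}
    (hc : E.curv ∈ scalarSubmodule A t 2) (i : ℕ) :
    (M.gr t i).Acyclic ↔ ∀ (j : ℤ) (x : M.X (j + 1)) (z : M.X (j + 1 + 1)),
      M.scal (t ^ i) _ (M.d (j + 1) x) = M.scal (t ^ (i + 1)) _ z →
      ∃ y z', M.scal (t ^ i) _ x = M.scal (t ^ i) _ (M.d j y) + M.scal (t ^ (i + 1)) _ z' := by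
  refine forall_congr' fun j => ⟨fun h x z hz => ?_, fun h x => ?_⟩
  · have h0 : (M.gr t i).d (j + 1) (M.grMk t i x) = 0 := by
      rw [gr_d_grMk, ← grMk_zero, eq_comm, grMk_eq_iff]
      exact ⟨z, by rw [hz, map_zero, zero_add]⟩
    obtain ⟨y, hy⟩ := (h _).1 h0
    obtain ⟨y, rfl⟩ := M.grMk_surjective t i y
    rw [gr_d_grMk, grMk_eq_iff] at hy
    exact ⟨y, hy⟩
  · constructor
    · intro h0
      obtain ⟨x, rfl⟩ := M.grMk_surjective t i x
      rw [gr_d_grMk, ← grMk_zero, eq_comm, grMk_eq_iff] at h0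
      obtain ⟨z, hz⟩ := h0
      rw [map_zero, zero_add] at hz
      obtain ⟨y, z', hy⟩ := h x z hz
      exact ⟨M.grMk t i y, by rw [gr_d_grMk, grMk_eq_iff]; exact ⟨z', hy⟩⟩
    · rintro ⟨y, rfl⟩
      obtain ⟨y, rfl⟩ := M.grMk_surjective t i y
      rw [gr_d_grMk, gr_d_grMk, ← grMk_zero, eq_comm, grMk_eq_iff]
      obtain ⟨m, hm⟩ := M.scal_d_d hc j y
      exact ⟨m, by rw [hm, map_zero, zero_add, pow_succ, scal_mul]⟩

theorem gr_acyclic_of_scal_eq_zero (M : CDGModule.{u, v, w} E) {t : R}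
    (hc : E.curv ∈ scalarSubmodule A t 2) {i : ℕ} (h : ∀ j m, M.scal (t ^ i) j m = 0) :
    (M.gr t i).Acyclic := by
  rw [gr_acyclic_iff M hc]
  intro j x z _
  exact ⟨0, 0, by simp [h]⟩

/-- On `t ^ q M` the square of the differential is divisible by `t ^ (q + 1)`, which acts by zero,
so `t ^ q M` is a genuine complex although `M` need not be. -/
theorem im_acyclic_iff (M : CDGModule.{u, v, w} E) {t : R}
    (hc : E.curv ∈ scalarSubmodule A t 2) {q : ℕ} (hq : t ^ (q + 1) • E.one = 0) :
    (M.im (t ^ q)).Acyclic ↔ ∀ (j : ℤ) (x : M.X (j + 1)),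
      M.scal (t ^ q) _ (M.d (j + 1) x) = 0 →
      ∃ y, M.scal (t ^ q) _ x = M.scal (t ^ q) _ (M.d j y) := by
  refine forall_congr' fun j => ⟨fun h x hx => ?_, fun h x => ⟨fun hx => ?_, ?_⟩⟩
  · obtain ⟨⟨_, y, rfl⟩, hy⟩ := (h ⟨_, x, rfl⟩).1 (Subtype.ext ((M.d_scal _ _ x).trans hx))
    exact ⟨y, (congrArg Subtype.val hy).symm.trans (M.d_scal _ _ y)⟩
  · obtain ⟨_, x, rfl⟩ := x
    obtain ⟨y, hy⟩ := h x ((M.d_scal _ _ x).symm.trans (congrArg Subtype.val hx))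
    exact ⟨⟨_, y, rfl⟩, Subtype.ext ((M.d_scal _ _ y).trans hy.symm)⟩
  · rintro ⟨⟨_, y, rfl⟩, rfl⟩
    refine Subtype.ext ?_
    change M.d (j + 1) (M.d j (M.scal (t ^ q) j y)) = 0
    rw [d_scal, d_scal]
    obtain ⟨m, hm⟩ := M.scal_d_d hc j y
    rw [hm, ← scal_mul, ← pow_succ, scal_eq_zero _ hq]

theorem im_acyclic_iff_gr_acyclic (M : CDGModule.{u, v, w} E) {t : R}
    (hc : E.curv ∈ scalarSubmodule A t 2) {q : ℕ} (hq : t ^ (q + 1) • E.one = 0) :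
    (M.im (t ^ q)).Acyclic ↔ (M.gr t q).Acyclic := by
  rw [im_acyclic_iff M hc hq, gr_acyclic_iff M hc]
  simp [scal_eq_zero M hq]

/-- The elementwise criterion involves only the differential and the powers of `t`, and restriction
leaves both unchanged. -/
theorem gr_res_acyclic_iff (φ : CDGAlgebraHom σ E F) (N : CDGModule.{u', v', w} F) {t : R}
    (hc : E.curv ∈ scalarSubmodule A t 2) (i : ℕ) :
    ((N.res φ).gr t i).Acyclic ↔ (N.gr (σ t) i).Acyclic := by
  have hc' : F.curv ∈ scalarSubmodule B (σ t) 2 := by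
    obtain ⟨c, hc⟩ := hc
    refine ⟨φ.toFun 2 c, ?_⟩
    rw [← φ.map_curv, ← hc]
    exact (map_smulₛₗ (φ.toFun 2) t c).symm
  rw [gr_acyclic_iff _ hc, gr_acyclic_iff _ hc']
  simp only [res_scal, map_pow]
  rfl

theorem nAcyclic_of_nAcyclic_res (φ : CDGAlgebraHom σ E F) {N : CDGModule.{u', v', w} F} {t : R}
    (hc : E.curv ∈ scalarSubmodule A t 2) {p q : ℕ} (hpq : p ≤ q)
    (hN : (N.res φ).NAcyclic t q) : N.NAcyclic (σ t) p := fun i hi =>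
  (gr_res_acyclic_iff φ N hc i).1 (hN i (hi.trans hpq))

theorem acyclic_of_nAcyclic_zero {M : CDGModule.{u, v, w} E} {t : R}
    (hc : E.curv ∈ scalarSubmodule A t 2) (ht : t • E.one = 0) (hM : M.NAcyclic t 0) :
    M.Acyclic := by
  have h := (gr_acyclic_iff M hc 0).1 (hM 0 le_rfl)
  simp only [zero_add, pow_zero, pow_one, scal_one, scal_eq_zero M ht, add_zero] at h
  refine fun j x => ⟨fun hx => ?_, ?_⟩
  · obtain ⟨y, -, hy⟩ := h j x 0 hx
    exact ⟨y, hy.symm⟩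
  · rintro ⟨y, rfl⟩
    obtain ⟨m, hm⟩ := M.scal_d_d hc j y
    rw [hm, scal_eq_zero M ht]

/-! ### Cones of reductions -/

theorem cone_scal {M N : CDGModule.{u, v, w} E} (G : M ⟶ N) (r : R) {j : ℤ}
    (x : M.X (j + 1)) (y : N.X j) :
    (cone G).scal r j (x, y) = (M.scal r (j + 1) x, N.scal r j y) := by
  refine Prod.ext ?_ rfl
  change (0 : ℤ).negOnePow • M.scal r (j + 1) x = _
  rw [Int.negOnePow_zero, one_smul]

theorem cone_d {M N : CDGModule.{u, v, w} E} (G : M ⟶ N) {j : ℤ}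
    (x : M.X (j + 1)) (y : N.X j) :
    (cone G).d j (x, y) = (-M.d (j + 1) x, G.f (j + 1) x + N.d j y) := rfl

/-- For `i ≤ p` the kernel of `π` lies in `t ^ (i + 1) C`, so `C` and `D` have the same graded
piece; for `i > p` that of `D` is zero. -/
theorem nAcyclic_of_surjective {t : R} (hc : E.curv ∈ scalarSubmodule A t 2) {p q : ℕ}
    {C D : CDGModule.{u, v, w} E} (π : C ⟶ D) (hπ : ∀ j, Function.Surjective (π.f j))
    (hker : ∀ j x, π.f j x = 0 → ∃ y, C.scal (t ^ (p + 1)) j y = x)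
    (hD : ∀ j y, D.scal (t ^ (p + 1)) j y = 0) (hC : C.NAcyclic t q) : D.NAcyclic t q := by
  intro i hi
  by_cases hip : i ≤ p
  · rw [gr_acyclic_iff _ hc]
    intro j x z hz
    obtain ⟨x, rfl⟩ := hπ _ x
    obtain ⟨z, rfl⟩ := hπ _ z
    rw [← π.map_d, ← Hom.map_scal, ← Hom.map_scal, ← sub_eq_zero, ← map_sub] at hz
    obtain ⟨c, hc'⟩ := hker _ _ hz
    -- With `p = i + e`, the lifting error in `t ^ (p + 1) C` is absorbed into the term in `t ^ (i +
    -- 1) C`.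
    obtain ⟨e, rfl⟩ := Nat.exists_eq_add_of_le hip
    rw [show i + e + 1 = i + 1 + e by omega, pow_add, scal_mul, eq_sub_iff_add_eq', ← map_add]
      at hc'
    obtain ⟨y, z', hy⟩ := (gr_acyclic_iff _ hc i).1 (hC i hi) j x _ hc'.symm
    refine ⟨π.f _ y, π.f _ z', ?_⟩
    rw [← π.map_d, ← Hom.map_scal, ← Hom.map_scal, ← Hom.map_scal, ← map_add, hy]
  · exact gr_acyclic_of_scal_eq_zero _ hc
      (fun j => scal_pow_eq_zero _ (show p + 1 ≤ i by omega) (hD j))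

/-- For `i ≤ p` the map `π` is an isomorphism on graded pieces, so its cone is acyclic there without
any assumption on `C`. For `i > p` the target contributes nothing and the cone is a shift of the
piece of `C`. -/
theorem nAcyclic_cone_of_surjective {t : R} (hc : E.curv ∈ scalarSubmodule A t 2) {p q : ℕ}
    {C D : CDGModule.{u, v, w} E} (π : C ⟶ D) (hπ : ∀ j, Function.Surjective (π.f j))
    (hker : ∀ j x, π.f j x = 0 → ∃ y, C.scal (t ^ (p + 1)) j y = x)
    (hD : ∀ j y, D.scal (t ^ (p + 1)) j y = 0)
    (hC : ∀ i ≤ q, p < i → (C.gr t i).Acyclic) : (cone π).NAcyclic t q := by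
  intro i hi
  rw [gr_acyclic_iff _ hc]
  rintro j ⟨x, y⟩ ⟨z, w⟩ h
  obtain ⟨y, rfl⟩ := hπ _ y
  obtain ⟨w, rfl⟩ := hπ _ w
  rw [cone_d, cone_scal, cone_scal, map_neg] at h
  obtain ⟨h1, h2⟩ := Prod.mk.inj h
  by_cases hip : i ≤ p
  · rw [← π.map_d, ← map_add, ← Hom.map_scal, ← Hom.map_scal, ← sub_eq_zero, ← map_sub] at h2
    obtain ⟨c, h2⟩ := hker _ _ h2
    obtain ⟨e, rfl⟩ := Nat.exists_eq_add_of_le hip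
    rw [show i + e + 1 = i + 1 + e by omega, pow_add, scal_mul, eq_sub_iff_add_eq',
      map_add] at h2
    -- The lift of the second component is itself a primitive: its image under `π` recovers that
    -- component, and the cocycle equation `h2` handles the first.
    refine ⟨(y, 0), (w + C.scal (t ^ e) _ c, 0), ?_⟩
    rw [cone_d, cone_scal, cone_scal, cone_scal, map_zero, map_zero, add_zero]
    refine Prod.ext ?_ (add_zero _).symm
    change C.scal (t ^ i) _ x = C.scal (t ^ i) _ (-C.d _ y) + C.scal (t ^ (i + 1)) _ _
    rw [map_neg, map_add, h2]
    abel
  · have hz : ∀ {j : ℤ} (m : D.X j), D.scal (t ^ i) j m = 0 :=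
      scal_pow_eq_zero _ (show p + 1 ≤ i by omega) (hD _)
    -- The signs on `z` and then on `a` compensate for the differential `-d` on the shifted summand
    -- of the cone.
    obtain ⟨a, z', h3⟩ := (gr_acyclic_iff C hc i).1 (hC i hi (by omega)) (j + 1) x (-z)
      (by rw [map_neg, ← h1, neg_neg])
    refine ⟨(-a, 0), (z', 0), ?_⟩
    rw [cone_d, cone_scal, cone_scal, cone_scal, hz, hz, map_zero (D.scal _ _), map_neg (C.d _),
      neg_neg]
    exact Prod.ext h3 (add_zero _).symm

end CDGModule

variable {φ : CDGAlgebraHom σ E F} {s : R} (hφ : φ.IsQuotientMap s)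

/-- The projection from the cone of `G` to the cone of its reduction. -/
def coneToReduction {M N : CDGModule.{u, v, w} E} (G : M ⟶ N) :
    CDGModule.cone G ⟶ (resFunctor φ).obj (CDGModule.cone ((reduction hφ).map G)) where
  f j := (M.redMk hφ (j + 1)).prodMap (N.redMk hφ j)
  map_act {i j l} h a m := by
    refine Prod.ext ?_ (N.red_act hφ h a m.2).symm
    change M.redMk hφ (l + 1) (i.negOnePow • M.act _ a m.1) =
      i.negOnePow • (M.red hφ).act _ (φ.toFun i a) (M.redMk hφ (j + 1) m.1)
    rw [CDGModule.red_act, Units.smul_def, Units.smul_def, map_zsmul]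
  map_d {j} m := by
    refine Prod.ext (map_neg (M.redMk hφ (j + 1 + 1)) _) ?_
    exact map_add (N.redMk hφ (j + 1)) _ _

/-- The cone of the reduced morphism is the cone of `G` modulo `t ^ (p + 1)`, so
`nAcyclic_of_surjective` applies. -/
theorem nAcyclic_cone_reduction {t : R} (hc : E.curv ∈ scalarSubmodule A t 2) {p q : ℕ}
    (hφ : φ.IsQuotientMap (t ^ (p + 1))) {M N : CDGModule.{u, v, w} E} (G : M ⟶ N)
    (hG : (CDGModule.cone G).NAcyclic t q) :
    ((CDGModule.cone ((reduction hφ).map G)).res φ).NAcyclic t q := by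
  refine CDGModule.nAcyclic_of_surjective hc (coneToReduction hφ G) (fun j => ?_) ?_
    (res_scal_eq_zero hφ (CDGModule.cone ((reduction hφ).map G))) hG
  · exact (M.redMk_surjective hφ _).prodMap (N.redMk_surjective hφ _)
  · rintro j ⟨x, y⟩ h
    obtain ⟨x', rfl⟩ := (M.redMk_eq_zero_iff hφ x).1 (congrArg Prod.fst h)
    obtain ⟨y', rfl⟩ := (N.redMk_eq_zero_iff hφ y).1 (congrArg Prod.snd h)
    exact ⟨(x', y'), CDGModule.cone_scal _ _ _ _⟩

theorem nAcyclic_cone_toReduction {t : R} (hc : E.curv ∈ scalarSubmodule A t 2) {p q : ℕ}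
    (hφ : φ.IsQuotientMap (t ^ (p + 1))) (M : CDGModule.{u, v, w} E)
    (hM : ∀ i ≤ q, p < i → (M.gr t i).Acyclic) :
    (CDGModule.cone (toReduction hφ M)).NAcyclic t q :=
  CDGModule.nAcyclic_cone_of_surjective hc (toReduction hφ M) (M.redMk_surjective hφ)
    (fun _ x => (M.redMk_eq_zero_iff hφ x).1)
    (res_scal_eq_zero hφ ((reduction hφ).obj M)) hM

/-! ### The cohomology of `rM` -/

namespace CDGModule

/-- The elements `x ∈ Mʲ⁺¹` such that `rx` is a cocycle. -/
def imCocycles (r : R) (j : ℤ) (M : CDGModule.{u, v, w} E) : AddSubgroup (M.X (j + 1)) :=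
  ((M.scal r _).comp (M.d (j + 1))).ker

/-- The elements `x ∈ Mʲ⁺¹` such that `rx` is a coboundary of `rM`. -/
def imCoboundaries (r : R) (j : ℤ) (M : CDGModule.{u, v, w} E) : AddSubgroup (M.X (j + 1)) :=
  (((M.scal r _).comp (M.d j)).range).comap (M.scal r _)

theorem mem_imCoboundaries {r : R} {j : ℤ} {M : CDGModule.{u, v, w} E} {x : M.X (j + 1)} :
    x ∈ M.imCoboundaries r j ↔ ∃ y, M.scal r _ (M.d j y) = M.scal r _ x := Iff.rfl

theorem Hom.map_mem_imCocycles {M N : CDGModule.{u, v, w} E} (G : M ⟶ N) {r : R} {j : ℤ}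
    {x : M.X (j + 1)} (hx : x ∈ M.imCocycles r j) : G.f _ x ∈ N.imCocycles r j := by
  change N.scal r _ (N.d _ (G.f _ x)) = 0
  rw [← G.map_d, ← Hom.map_scal]
  exact (congrArg _ hx).trans (map_zero _)

theorem Hom.map_mem_imCoboundaries {M N : CDGModule.{u, v, w} E} (G : M ⟶ N) {r : R} {j : ℤ}
    {x : M.X (j + 1)} (hx : x ∈ M.imCoboundaries r j) : G.f _ x ∈ N.imCoboundaries r j := by
  obtain ⟨y, hy⟩ := mem_imCoboundaries.1 hx
  exact mem_imCoboundaries.2 ⟨G.f _ y, by rw [← G.map_d, ← Hom.map_scal, ← Hom.map_scal, hy]⟩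

/-- The cohomology of `rM` in degree `j + 1`. -/
abbrev ImCohomology (r : R) (j : ℤ) (M : CDGModule.{u, v, w} E) : Type w :=
  -- Classes are represented by `x` in place of `rx`. The two subgroups are intersected because `d²
  -- = 0` on `rM` is not assumed at this stage.
  M.imCocycles r j ⧸ (M.imCoboundaries r j).addSubgroupOf (M.imCocycles r j)

/-- The map on the cohomology of `rM`. -/
def Hom.imCohomology {M N : CDGModule.{u, v, w} E} (G : M ⟶ N) (r : R) (j : ℤ) :
    M.ImCohomology r j →+ N.ImCohomology r j :=
  QuotientAddGroup.map _ _
    (((G.f (j + 1)).comp (M.imCocycles r j).subtype).codRestrict (N.imCocycles r j)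
      (fun x => Hom.map_mem_imCocycles G x.2))
    (fun _ hx => Hom.map_mem_imCoboundaries G hx)

theorem Hom.imCohomology_mk {M N : CDGModule.{u, v, w} E} (G : M ⟶ N) (r : R) (j : ℤ)
    (x : M.imCocycles r j) :
    Hom.imCohomology G r j (QuotientAddGroup.mk x) =
      QuotientAddGroup.mk ⟨G.f _ x.1, Hom.map_mem_imCocycles G x.2⟩ := rfl

/-- The homotopy `p` commutes with `r`, so on a cocycle `r • p (d x) = p (r • d x) = 0`, and only
the coboundary of `p x` survives. -/
theorem Hom.imCohomology_eq_of_homotopic {M N : CDGModule.{u, v, w} E} {G G' : M ⟶ N}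
    (h : Homotopic G G') (r : R) (j : ℤ) : Hom.imCohomology G r j = Hom.imCohomology G' r j := by
  obtain ⟨p, hp, hp'⟩ := h
  have hs : ∀ i m, p i (M.scal r (i + 1) m) = N.scal r i (p i m) := fun i m => by
    have := hp (zero_add i) (zero_add (i + 1)) (r • E.one) m
    rwa [Int.negOnePow_zero, one_smul] at this
  refine DFunLike.ext _ _ fun x => ?_
  obtain ⟨⟨x, hx⟩, rfl⟩ := QuotientAddGroup.mk_surjective x
  rw [imCohomology_mk, imCohomology_mk, QuotientAddGroup.eq]
  refine mem_imCoboundaries.2 ⟨-p j x, ?_⟩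
  have hx' : M.scal r _ (M.d _ x) = 0 := hx
  change _ = N.scal r _ (-G.f _ x + G'.f _ x)
  have h1 : -G.f _ x + G'.f _ x = -(G.f _ x - G'.f _ x) := by abel
  rw [h1, hp', map_neg, map_neg, map_neg, map_add, ← hs (j + 1), hx', map_zero, add_zero]

/-- This is the long exact sequence of the cone, by hand: the cocycle `(x, -y)` gives injectivity
when `y` bounds the image of `x`, and `(0, y)` gives surjectivity. -/
theorem Hom.imCohomology_bijective {M N : CDGModule.{u, v, w} E} (G : M ⟶ N) {t : R}
    (hc : E.curv ∈ scalarSubmodule A t 2) {q : ℕ} (hq : t ^ (q + 1) • E.one = 0)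
    (hG : ((cone G).im (t ^ q)).Acyclic) (j : ℤ) :
    Function.Bijective (Hom.imCohomology G (t ^ q) j) := by
  rw [im_acyclic_iff _ hc hq] at hG
  constructor
  · rw [injective_iff_map_eq_zero]
    intro x hx
    obtain ⟨⟨x, hx'⟩, rfl⟩ := QuotientAddGroup.mk_surjective x
    rw [imCohomology_mk, QuotientAddGroup.eq_zero_iff] at hx
    rw [QuotientAddGroup.eq_zero_iff]
    obtain ⟨y, hy⟩ := mem_imCoboundaries.1 hx
    have hx0 : M.scal (t ^ q) _ (M.d _ x) = 0 := hx'
    -- The cone shifts its source by one, so `x` sits in the cone one degree lower than in `M`.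
    obtain ⟨j, rfl⟩ : ∃ j', j = j' + 1 := ⟨j - 1, by omega⟩
    replace hy : N.scal (t ^ q) _ (N.d _ y) = N.scal (t ^ q) _ (G.f _ x) := hy
    obtain ⟨⟨a, b⟩, hab⟩ := hG j (x, -y) (by
      rw [cone_d, cone_scal, map_neg, hx0, map_neg, map_add, map_neg, hy, neg_zero, add_neg_cancel]
      rfl)
    rw [cone_d, cone_scal, cone_scal] at hab
    exact mem_imCoboundaries.2 ⟨-a, by
      rw [map_neg (M.d _)]
      exact (congrArg Prod.fst hab).symm⟩
  · intro y
    obtain ⟨⟨y, hy⟩, rfl⟩ := QuotientAddGroup.mk_surjective y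
    have hy' : N.scal (t ^ q) _ (N.d _ y) = 0 := hy
    obtain ⟨⟨a, b⟩, hab⟩ := hG j (0, y) (by
      rw [cone_d, cone_scal, map_zero, map_zero, zero_add, hy', neg_zero, map_zero]
      rfl)
    rw [cone_d, cone_scal, cone_scal] at hab
    have h1 : M.scal (t ^ q) _ 0 = M.scal (t ^ q) _ (-M.d _ a) := congrArg Prod.fst hab
    have h2 : N.scal (t ^ q) _ y = N.scal (t ^ q) _ (G.f _ a + N.d _ b) := congrArg Prod.snd hab
    have ha : a ∈ M.imCocycles (t ^ q) j := by
      change M.scal (t ^ q) _ (M.d _ a) = 0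
      rwa [map_zero, map_neg, eq_comm, neg_eq_zero] at h1
    refine ⟨QuotientAddGroup.mk ⟨a, ha⟩, ?_⟩
    rw [imCohomology_mk, QuotientAddGroup.eq]
    refine mem_imCoboundaries.2 ⟨b, ?_⟩
    change _ = N.scal _ _ (-G.f _ a + y)
    rw [map_add, h2, map_add, map_neg, neg_add_cancel_left]

theorem im_acyclic_iff_subsingleton (M : CDGModule.{u, v, w} E) {t : R}
    (hc : E.curv ∈ scalarSubmodule A t 2) {q : ℕ} (hq : t ^ (q + 1) • E.one = 0) :
    (M.im (t ^ q)).Acyclic ↔ ∀ j, Subsingleton (M.ImCohomology (t ^ q) j) := by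
  rw [im_acyclic_iff M hc hq]
  refine forall_congr' fun j => ?_
  rw [QuotientAddGroup.subsingleton_iff, AddSubgroup.addSubgroupOf_eq_top]
  exact forall_congr' fun x => imp_congr_right fun _ => exists_congr fun y => eq_comm

end CDGModule

/-- The cohomology of `rM` as a functor on the homotopy category. -/
def imCohomologyFunctor (E : CDGAlgebra R A) (r : R) (j : ℤ) : Hot.{u, v, w} E ⥤ Type w :=
  CategoryTheory.Quotient.lift _
    { obj := fun M => M.ImCohomology r j
      map := fun G => TypeCat.ofHom (CDGModule.Hom.imCohomology G r j)
      map_id := fun M => by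
        ext x
        obtain ⟨x, rfl⟩ := QuotientAddGroup.mk_surjective x
        rfl
      map_comp := fun G H => by
        ext x
        obtain ⟨x, rfl⟩ := QuotientAddGroup.mk_surjective x
        rfl }
    (fun _ _ G G' h => by
      change TypeCat.ofHom _ = TypeCat.ofHom _
      rw [CDGModule.Hom.imCohomology_eq_of_homotopic h])

theorem imCohomologyFunctor_inverts {t : R} (hc : E.curv ∈ scalarSubmodule A t 2) {q : ℕ}
    (hq : t ^ (q + 1) • E.one = 0) (j : ℤ) :
    (coneProp (CDGModule.NAcyclic.{u, v, w} (E := E) t q)).IsInvertedBy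
      (imCohomologyFunctor E (t ^ q) j) := by
  rintro M N f ⟨G, rfl, hG⟩
  rw [isIso_iff_bijective]
  exact CDGModule.Hom.imCohomology_bijective G hc hq
    ((CDGModule.im_acyclic_iff_gr_acyclic _ hc hq).2 (hG q le_rfl)) j

/-- An isomorphism in the Verdier quotient need not come from a morphism of modules, but the
cohomology of `t ^ q M` factors through that quotient and so carries it to a bijection. -/
theorem im_acyclic_of_iso {t : R} (hc : E.curv ∈ scalarSubmodule A t 2) {q : ℕ}
    (hq : t ^ (q + 1) • E.one = 0) {M N : CDGModule.{u, v, w} E}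
    (e : (toVerdier (CDGModule.NAcyclic t q)).obj M ≅ (toVerdier (CDGModule.NAcyclic t q)).obj N)
    (hM : (M.im (t ^ q)).Acyclic) : (N.im (t ^ q)).Acyclic := by
  rw [CDGModule.im_acyclic_iff_subsingleton _ hc hq] at hM ⊢
  intro j
  have hfac := Localization.Construction.fac _ (imCohomologyFunctor_inverts.{u, v, w} hc hq j)
  let e' : (imCohomologyFunctor E (t ^ q) j).obj ((toHot E).obj M) ≅
      (imCohomologyFunctor E (t ^ q) j).obj ((toHot E).obj N) :=
    (eqToIso hfac).symm.app _ ≪≫ (Localization.Construction.lift _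
      (imCohomologyFunctor_inverts.{u, v, w} hc hq j)).mapIso e ≪≫ (eqToIso hfac).app _
  have : Subsingleton ((imCohomologyFunctor E (t ^ q) j).obj ((toHot E).obj M)) := hM j
  exact e'.toEquiv.symm.subsingleton

/-! ### Restriction of scalars along quotient maps -/

/-- For `F = E / tᵖ⁺¹E`, restriction of scalars is fully faithful on the quotients by the
`q`-acyclic modules. -/
theorem resVerdier_fullyFaithful_of_nAcyclic {t : R} (hc : E.curv ∈ scalarSubmodule A t 2)
    {p q : ℕ} (hφ : φ.IsQuotientMap (t ^ (p + 1))) {P : CDGModule.{u', v', w} F → Prop}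
    (hP : ∀ M, P M → (M.res φ).NAcyclic t q) (hP' : ∀ M, (M.res φ).NAcyclic t q → P M) :
    (resVerdier.{u, u', v, v', w} φ hP).Full ∧ (resVerdier.{u, u', v, v', w} φ hP).Faithful :=
  resVerdier_fullyFaithful hφ hP (fun G hG => hP' _ (nAcyclic_cone_reduction hc hφ G hG))

theorem resVerdier_essImage_iff {t : R} (hc : E.curv ∈ scalarSubmodule A t 2)
    {p : ℕ} (hp : t ^ (p + 1 + 1) • E.one = 0)
    (hφ : φ.IsQuotientMap (t ^ (p + 1))) {P : CDGModule.{u', v', w} F → Prop}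
    (hP : ∀ M, P M → (M.res φ).NAcyclic t (p + 1)) (M : CDGModule.{u, v, w} E) :
    (resVerdier.{u, u', v, v', w} φ hP).essImage ((toVerdier _).obj M) ↔
      (M.im (t ^ (p + 1))).Acyclic := by
  constructor
  · intro h
    obtain ⟨N, ⟨e⟩⟩ := exists_iso_of_essImage hP M h
    refine im_acyclic_of_iso hc hp e ?_
    rw [CDGModule.im_acyclic_iff_gr_acyclic _ hc hp]
    exact CDGModule.gr_acyclic_of_scal_eq_zero _ hc (res_scal_eq_zero hφ N)
  · intro h
    refine essImage_of_cone_toReduction hφ hP M (nAcyclic_cone_toReduction hc hφ M ?_)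
    intro i hi hi'
    -- With `q = p + 1`, the top graded piece is the only one not controlled by the reduction.
    obtain rfl : i = p + 1 := by omega
    rwa [← CDGModule.im_acyclic_iff_gr_acyclic _ hc hp]

end

/-! ### The chain of embeddings -/

namespace CDGAlgebra

variable {R : Type u} [CommRing R] {A : ℤ → Type v}
  [∀ i, AddCommGroup (A i)] [∀ i, Module R (A i)] (E : CDGAlgebra R A)

theorem quotProj_isQuotientMap (r : R) : (E.quotProj r).IsQuotientMap r where
  surjective _ := Submodule.mkQ_surjective _
  mem_of_eq_zero _ := (Submodule.Quotient.mk_eq_zero _).1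
  smul_one := E.quot_smul_one r

theorem quotFactor_isQuotientMap {r s : R} (h : s ∣ r) : (E.quotFactor h).IsQuotientMap s where
  surjective i x := by
    obtain ⟨x, rfl⟩ := Submodule.Quotient.mk_surjective _ x
    exact ⟨Submodule.Quotient.mk x, rfl⟩
  mem_of_eq_zero a ha := by
    obtain ⟨a, rfl⟩ := Submodule.Quotient.mk_surjective _ a
    obtain ⟨b, rfl⟩ := (Submodule.Quotient.mk_eq_zero _).1 ha
    exact ⟨Submodule.Quotient.mk b, rfl⟩
  smul_one := E.quot_smul_one s

end CDGAlgebra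

section

variable {k : Type u} [CommRing k] {A : ℤ → Type v}
  [∀ i, AddCommGroup (A i)] [∀ i, Module k (A i)]

/-! ### The kernel of reduction modulo `t` -/

theorem TruncPoly.exists_eq_add_t_mul (n : ℕ) (r : TruncPoly k n) :
    ∃ r', r = algebraMap k _ (TruncPoly.aug k n r) + TruncPoly.t k n * r' := by
  obtain ⟨f, rfl⟩ := Ideal.Quotient.mk_surjective r
  obtain ⟨g, hg⟩ : (Polynomial.X : k[X]) ∣ f - Polynomial.C (f.eval 0) := by
    rw [Polynomial.X_dvd_iff]
    simp [Polynomial.coeff_zero_eq_eval_zero]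
  refine ⟨Ideal.Quotient.mk _ g, ?_⟩
  have h1 : TruncPoly.aug k n (Ideal.Quotient.mk _ f) = f.eval 0 := by
    change Polynomial.aeval (0 : k) f = _
    rw [Polynomial.coe_aeval_eq_eval]
  rw [h1, TruncPoly.t, ← map_mul, ← hg, map_sub]
  exact (add_sub_cancel _ _).symm

theorem exists_eq_tmul_add_smul (n : ℕ) {i : ℤ} (x : TruncPoly k n ⊗[k] A i) :
    ∃ y, x = 1 ⊗ₜ redMap A n i x + TruncPoly.t k n • y := by
  induction x using TensorProduct.induction_on with
  | zero => exact ⟨0, by simp⟩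
  | tmul r a =>
    obtain ⟨r', hr⟩ := TruncPoly.exists_eq_add_t_mul n r
    refine ⟨r' ⊗ₜ a, ?_⟩
    rw [redMap_tmul, TensorProduct.tmul_smul, TensorProduct.smul_tmul', TensorProduct.smul_tmul',
      ← TensorProduct.add_tmul, smul_eq_mul, ← Algebra.algebraMap_eq_smul_one, ← hr]
  | add x y hx hy =>
    obtain ⟨x', hx⟩ := hx
    obtain ⟨y', hy⟩ := hy
    refine ⟨x' + y', ?_⟩
    rw [map_add, TensorProduct.tmul_add, smul_add]
    nth_rw 1 [hx, hy]
    abel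

/-- Any `x` differs from the constant lift of its reduction by a multiple of `t`. This makes the
curvature divisible by `t` and the map from level zero to `A` injective. -/
theorem mem_scalarSubmodule_t_of_redMap_eq_zero {n : ℕ} {i : ℤ} {x : TruncPoly k n ⊗[k] A i}
    (hx : redMap A n i x = 0) :
    x ∈ scalarSubmodule (fun i => TruncPoly k n ⊗[k] A i) (TruncPoly.t k n) i := by
  obtain ⟨y, hy⟩ := exists_eq_tmul_add_smul n x
  rw [hx, TensorProduct.tmul_zero, zero_add] at hy
  exact ⟨y, hy.symm⟩

namespace CDGDeformation

variable {dA : DGAlgebra k A} {n : ℕ} (E : CDGDeformation dA n)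

theorem curv_mem : E.curv ∈
    scalarSubmodule (fun i => TruncPoly k n ⊗[k] A i) (TruncPoly.t k n) 2 :=
  mem_scalarSubmodule_t_of_redMap_eq_zero E.red_curv

theorem level_curv_mem (m : ℕ) : (E.level m).curv ∈ scalarSubmodule
    (fun i => (TruncPoly k n ⊗[k] A i) ⧸ scalarSubmodule (fun i => TruncPoly k n ⊗[k] A i)
      (TruncPoly.t k n ^ (m + 1)) i) (TruncPoly.t k n) 2 := by
  obtain ⟨c, hc⟩ := E.curv_mem
  exact ⟨Submodule.Quotient.mk c, congrArg Submodule.Quotient.mk hc⟩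

theorem t_pow_smul_one : TruncPoly.t k n ^ (n + 1) • E.one = 0 := by
  rw [TruncPoly.t_pow]
  exact zero_smul (TruncPoly k n) E.one

/-- This map is an isomorphism; regarding it as the quotient by `t`, which acts by zero on the
source, brings it under the general argument with `p = 0`. -/
theorem levelZeroHom_isQuotientMap :
    E.levelZeroHom.IsQuotientMap (TruncPoly.t k n ^ (0 + 1)) where
  surjective i a := ⟨Submodule.Quotient.mk (1 ⊗ₜ a), by
    change redMap A n i (1 ⊗ₜ a) = a
    rw [redMap_tmul, map_one, one_smul]⟩
  mem_of_eq_zero {i} a ha := by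
    obtain ⟨a, rfl⟩ := Submodule.Quotient.mk_surjective _ a
    have ha' := mem_scalarSubmodule_t_of_redMap_eq_zero (show redMap A n i a = 0 from ha)
    refine ⟨0, (map_zero _).trans ((Submodule.Quotient.mk_eq_zero _).2 ?_).symm⟩
    rwa [zero_add, pow_one]
  smul_one := by
    rw [zero_add, pow_one]
    change TruncPoly.aug k n (TruncPoly.t k n) • _ = _
    rw [TruncPoly.aug_t, zero_smul]

theorem levelZero_t_smul_one : TruncPoly.t k n • (E.level 0).one = 0 := by
  refine (Submodule.Quotient.mk_eq_zero _).2 ?_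
  rw [zero_add, pow_one]
  exact ⟨E.one, rfl⟩

theorem derivedToLevelZero_isEquivalence :
    (CDGDeformation.derivedToLevelZero.{u, v, w} E).IsEquivalence := by
  obtain ⟨h1, h2⟩ : E.derivedToLevelZero.Full ∧ E.derivedToLevelZero.Faithful :=
    resVerdier_fullyFaithful_of_nAcyclic (E.level_curv_mem 0) E.levelZeroHom_isQuotientMap _
      (fun M hM => (CDGModule.acyclic_of_nAcyclic_zero (E.level_curv_mem 0)
        E.levelZero_t_smul_one hM :))
  -- The condition on the cone of `X → X / tX` concerns indices with `0 < i ≤ 0`, so it is empty.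
  have h3 : E.derivedToLevelZero.EssSurj := ⟨fun X => by
    obtain ⟨X, rfl⟩ := (Localization.Construction.objEquiv _).surjective X
    exact essImage_of_cone_toReduction E.levelZeroHom_isQuotientMap _ X.as
      (nAcyclic_cone_toReduction (E.level_curv_mem 0) E.levelZeroHom_isQuotientMap X.as
        (fun i hi hi' => by omega))⟩
  exact { }

theorem levelIota_fullyFaithful (m : ℕ) :
    (CDGDeformation.levelIota.{u, v, w} E m).Full ∧
      (CDGDeformation.levelIota.{u, v, w} E m).Faithful :=
  resVerdier_fullyFaithful_of_nAcyclic (E.level_curv_mem (m + 1))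
    (E.toCDGAlgebra.quotFactor_isQuotientMap _) _
    (fun _ => CDGModule.nAcyclic_of_nAcyclic_res _ (E.level_curv_mem (m + 1)) (by omega))

theorem levelIota_essImage_iff (m : ℕ) (M : CDGModule.{u, max u v, w} (E.level (m + 1))) :
    (CDGDeformation.levelIota.{u, v, w} E m).essImage ((toVerdier _).obj M) ↔
      (M.im (TruncPoly.t k n ^ (m + 1))).Acyclic :=
  resVerdier_essImage_iff (E.level_curv_mem (m + 1)) (E.toCDGAlgebra.quot_smul_one _)
    (E.toCDGAlgebra.quotFactor_isQuotientMap _) _ M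

end CDGDeformation

end

end

theorem mainTheorem7 {k : Type u} [CommRing k] {A : ℤ → Type v}
    [∀ i, AddCommGroup (A i)] [∀ i, Module k (A i)] (dA : DGAlgebra k A) (n : ℕ)
    (E : CDGDeformation dA (n + 1)) :
    -- the forgetful functor from the `n`-derived category of `Aₙ` to the `(n+1)`-derived category
    -- of `Aₙ₊₁` is fully faithful
    ((CDGDeformation.iota.{u, v, w} E n).Full ∧ (CDGDeformation.iota.{u, v, w} E n).Faithful) ∧
    -- its essential image consists of the modules `M` such that `tⁿ⁺¹ M` is acyclic
    (∀ M : CDGModule.{u, max u v, w} E.toCDGAlgebra,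
      (CDGDeformation.iota.{u, v, w} E n).essImage ((toVerdier _).obj M) ↔
        (M.im (TruncPoly.t k (n + 1) ^ (n + 1))).Acyclic) ∧
    -- the other arrows of the chain of embeddings which starts at `D(A)`
    (CDGDeformation.derivedToLevelZero.{u, v, w} E).IsEquivalence ∧
    (∀ m < n, (CDGDeformation.levelIota.{u, v, w} E m).Full ∧
      (CDGDeformation.levelIota.{u, v, w} E m).Faithful ∧
      ∀ M : CDGModule.{u, max u v, w} (E.level (m + 1)),
        (CDGDeformation.levelIota.{u, v, w} E m).essImage ((toVerdier _).obj M) ↔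
          (M.im (TruncPoly.t k (n + 1) ^ (m + 1))).Acyclic) :=
  -- The top arrow uses the deformation itself in place of its quotient by `t ^ (n + 2) = 0`, hence
  -- `quotProj`; the lower arrows use `quotFactor`.
  ⟨resVerdier_fullyFaithful_of_nAcyclic E.curv_mem (E.toCDGAlgebra.quotProj_isQuotientMap _) _
      (fun _ => CDGModule.nAcyclic_of_nAcyclic_res _ E.curv_mem (by omega)),
    fun M => resVerdier_essImage_iff E.curv_mem E.t_pow_smul_one
      (E.toCDGAlgebra.quotProj_isQuotientMap _) _ M,
    E.derivedToLevelZero_isEquivalence,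
    fun m _ => ⟨(E.levelIota_fullyFaithful m).1, (E.levelIota_fullyFaithful m).2,
      E.levelIota_essImage_iff m⟩⟩
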